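/- Let $M$ be a connected smooth manifold of finite dimension $n$ (Hausdorff, second countable, without boundary), let $U\subset\mathbb R^m$ be an arbitrary set, and let $F:M\times U\to TM$ be smooth with $F(x,v)\in T_xM$ for all $x\in M$, $v\in U$. Consider the control system $$\dot x=F(x,u(t)),\qquad x\in M,$$ where the class $\mathcal U$ of admissible controls is either the class of all piecewise constant maps $u:[0,T]\to U$, $T\ge 0$, or the class of all $u\in L^\infty([0,T],U)$, $T\ge0$. For $x\in M$ let the attainable set $\mathcal A_x$ be the set of all points $\gamma(T)$, where $T\ge 0$ and $\gamma:[0,T]\to M$ is an absolutely continuous curve with $\gamma(0)=x$ and $\dot\gamma(t)=F(\gamma(t),u(t))$ for almost every $t\in[0,T]$, for some $u\in\mathcal U$ defined on $[0,T]$. In the case of $L^\infty$ controls assume that $U$ is closed or, more generally, that in local coordinates near any point of $M$, and for every $R>0$, the vector fields $F(\cdot,v)$ with $v\in U$, $|v|\le R$, are uniformly bounded and uniformly Lipschitz (so that the differential equation is well posed for every control). Assume that the system is locally controllable, i.e. $x\in\operatorname{Int}\mathcal A_x$ for every $x\in M$. Then, for all $x,y\in M$, $$y\in\mathcal A_x\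 \Longrightarrow\ x\in\mathcal A_y.$$ -/

import Mathlib

open Set MeasureTheory Topology
open scoped Manifold ContDiff NNReal ENNReal

namespace ControlSystem

/-- The two classes of controls: piecewise constant ones, and essentially bounded measurable
ones. -/
inductive ControlClass
  | piecewiseConstant
  | essentiallyBounded

/-- `u` restricted to `[0, T]` is a piecewise constant map `[0, T] → U`: there is a finite
subdivision `0 = τ 0 ≤ τ 1 ≤ ⋯ ≤ τ N = T` such that `u` is constant on every open interval
`(τ i, τ (i + 1))`. -/
def IsPiecewiseConstantControl {m : ℕ} (U : Set (EuclideanSpace ℝ (Fin m))) (T : ℝ)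
    (u : ℝ → EuclideanSpace ℝ (Fin m)) : Prop :=
  (∀ t ∈ Icc 0 T, u t ∈ U) ∧
    ∃ (N : ℕ) (τ : ℕ → ℝ), Monotone τ ∧ τ 0 = 0 ∧ τ N = T ∧
      ∀ i < N, ∃ v ∈ U, ∀ t ∈ Ioo (τ i) (τ (i + 1)), u t = v

/-- `u` restricted to `[0, T]` (represents a class that) belongs to `L^∞([0, T], U)`. -/
def IsEssentiallyBoundedControl {m : ℕ} (U : Set (EuclideanSpace ℝ (Fin m))) (T : ℝ)
    (u : ℝ → EuclideanSpace ℝ (Fin m)) : Prop :=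
  MemLp u ∞ (volume.restrict (Icc 0 T)) ∧ ∀ᵐ t ∂volume.restrict (Icc 0 T), u t ∈ U

/-- `u`, restricted to `[0, T]`, is an admissible control of the class `𝒰`. -/
def IsAdmissible {m : ℕ} (𝒰 : ControlClass) (U : Set (EuclideanSpace ℝ (Fin m))) (T : ℝ)
    (u : ℝ → EuclideanSpace ℝ (Fin m)) : Prop :=
  match 𝒰 with
  | .piecewiseConstant => IsPiecewiseConstantControl U T u
  | .essentiallyBounded => IsEssentiallyBoundedControl U T u

section

variable {n m : ℕ} {M : Type*} [TopologicalSpace M] [ChartedSpace (EuclideanSpace ℝ (Fin n)) M]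

/-- `F` is smooth on `M × U`, as a map into the tangent bundle. The values of `F` at controls
outside `U` are irrelevant. -/
def IsSmoothSystem [IsManifold (𝓡 n) ∞ M]
    (F : (x : M) → EuclideanSpace ℝ (Fin m) → TangentSpace (𝓡 n) x)
    (U : Set (EuclideanSpace ℝ (Fin m))) : Prop :=
  ContMDiffOn ((𝓡 n).prod (𝓡 m)) (𝓡 n).tangent ∞
    (fun p : M × EuclideanSpace ℝ (Fin m) ↦
      (⟨p.1, F p.1 p.2⟩ : TangentBundle (𝓡 n) M)) (univ ×ˢ U)

/-- The expression of the vector field `F (·, v)` in the chart of `M` centred at `x₀`. -/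
noncomputable def inChart (F : (x : M) → EuclideanSpace ℝ (Fin m) → TangentSpace (𝓡 n) x)
    (x₀ : M) (v : EuclideanSpace ℝ (Fin m)) (z : EuclideanSpace ℝ (Fin n)) :
    EuclideanSpace ℝ (Fin n) :=
  mfderiv (𝓡 n) (𝓡 n) (extChartAt (𝓡 n) x₀) ((extChartAt (𝓡 n) x₀).symm z)
    (F ((extChartAt (𝓡 n) x₀).symm z) v)

/-- Locally in `x`, and in coordinates, the vector fields `F (·, v)` are bounded and Lipschitz
uniformly in `v ∈ U` with `‖v‖ ≤ R`, for every `R`. If `F` is smooth on `M × U`, this is automatic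
when `U` is closed. -/
def IsLocallyLipschitzOnBoundedControls
    (F : (x : M) → EuclideanSpace ℝ (Fin m) → TangentSpace (𝓡 n) x)
    (U : Set (EuclideanSpace ℝ (Fin m))) : Prop :=
  ∀ (x₀ : M) (R : ℝ), ∃ N ∈ 𝓝 (extChartAt (𝓡 n) x₀ x₀), ∃ C : ℝ≥0,
    ∀ v ∈ U, ‖v‖ ≤ R →
      (∀ z ∈ N, ‖inChart F x₀ v z‖ ≤ C) ∧ LipschitzOnWith C (inChart F x₀ v) N

/-- `γ` is an absolutely continuous curve `[0, T] → M`: it is continuous, and its expression in a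
chart is absolutely continuous on every compact subinterval that `γ` maps into the domain of that
chart. -/
def IsAbsolutelyContinuousCurve (n : ℕ) {M : Type*} [TopologicalSpace M]
    [ChartedSpace (EuclideanSpace ℝ (Fin n)) M] (T : ℝ) (γ : ℝ → M) : Prop :=
  ContinuousOn γ (Icc 0 T) ∧
    ∀ (x₀ : M) (a b : ℝ), 0 ≤ a → a ≤ b → b ≤ T →
      (∀ t ∈ Icc a b, γ t ∈ (extChartAt (𝓡 n) x₀).source) →
        AbsolutelyContinuousOnInterval (fun t ↦ extChartAt (𝓡 n) x₀ (γ t)) a b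

/-- `γ` is an absolutely continuous solution on `[0, T]` of `γ' t = F (γ t, u t)`. -/
def IsTrajectory (F : (x : M) → EuclideanSpace ℝ (Fin m) → TangentSpace (𝓡 n) x) (T : ℝ)
    (u : ℝ → EuclideanSpace ℝ (Fin m)) (γ : ℝ → M) : Prop :=
  IsAbsolutelyContinuousCurve n T γ ∧
    ∀ᵐ t ∂volume.restrict (Icc 0 T),
      HasMFDerivAt 𝓘(ℝ, ℝ) (𝓡 n) γ t ((1 : ℝ →L[ℝ] ℝ).smulRight (F (γ t) (u t)))

/-- The attainable set from `x`: the end points `γ T` of the trajectories, defined on an interval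
`[0, T]` with `T ≥ 0`, that start at `x` and correspond to an admissible control. -/
def attainableSet (F : (x : M) → EuclideanSpace ℝ (Fin m) → TangentSpace (𝓡 n) x)
    (U : Set (EuclideanSpace ℝ (Fin m))) (𝒰 : ControlClass) (x : M) : Set M :=
  {y | ∃ (T : ℝ) (u : ℝ → EuclideanSpace ℝ (Fin m)) (γ : ℝ → M), 0 ≤ T ∧ IsAdmissible 𝒰 U T u ∧
    IsTrajectory F T u γ ∧ γ 0 = x ∧ γ T = y}

/-- Local controllability: every point is interior to its attainable set. -/
def IsLocallyControllable (F : (x : M) → EuclideanSpace ℝ (Fin m) → TangentSpace (𝓡 n) x)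
    (U : Set (EuclideanSpace ℝ (Fin m))) (𝒰 : ControlClass) : Prop :=
  ∀ x : M, x ∈ interior (attainableSet F U 𝒰 x)

end

end ControlSystem

/-! Let `B` be the set of points from which `x` can be attained. Concatenating trajectories shows
that `B` is invariant backwards in time (`attainableSet_trans`), so the claim is that a trajectory
starting in `B` can reach `y` without leaving `B`. Since nothing says that `B` is open or closed,
what is followed is a property finer than membership: lying on a `C¹` disk of dimension `k` immersed
in `B`, with `k` the largest dimension that occurs.

Three facts about such disks carry the proof. (1) They are transported backwards along any
trajectory, because short-time flows of measurable controls are `C¹` with injective derivative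
(`IsBoundedC1Family.exists_flow`, `HasImmersedDisk.of_isTrajectory`). (2) If a vector field of the
system is transverse to a disk in `B`, sweeping the disk backwards along that field yields a disk in
`B` of one dimension more (`exists_hasImmersedDisk_succ`). For maximal `k` all fields are therefore
tangent to the disk at all its points. (3) Hence, by a Gronwall estimate, a trajectory that starts
on a maximal disk remains on it for a short time (`HasImmersedDisk.exists_forall_le`).

Take `p` on a `k`-disk in `B`, and a trajectory from `p` through `x` to `y`. The set of times at
which it lies on a `k`-disk in `B` contains its supremum `c`: by local controllability `γ c` can
reach a slightly earlier point of the trajectory lying on such a disk, and (1) brings that disk to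
`γ c`. By (3) the supremum is the final time, so `y` belongs to `B`. -/

namespace ControlSystem

/-! ### Integral equations on short intervals, with right-hand side measurable in time -/

section Caratheodory

open Filter

/-- Absorption principle on a short interval: if every bound `K` for `e` improves to
`δ + K / 2`, then `e ≤ 2 δ`. -/
lemma le_two_mul_of_forall_bound {e : ℝ → ℝ} {h δ : ℝ} (he : ContinuousOn e (Icc 0 h))
    (hK : ∀ K, (∀ s ∈ Icc 0 h, e s ≤ K) → ∀ t ∈ Icc 0 h, e t ≤ δ + K / 2) :
    ∀ t ∈ Icc 0 h, e t ≤ 2 * δ := by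
  intro t ht
  obtain ⟨m, hm, hmax⟩ := isCompact_Icc.exists_isMaxOn ⟨t, ht⟩ he
  have h1 := hK (e m) (fun s hs ↦ hmax hs) m hm
  have h2 : e t ≤ e m := hmax ht
  linarith

lemma intervalIntegrable_of_bound {X : Type*} [NormedAddCommGroup X] {f : ℝ → X} {a b K : ℝ}
    (hf : AEStronglyMeasurable f (volume.restrict (uIoc a b)))
    (hK : ∀ s ∈ uIoc a b, ‖f s‖ ≤ K) : IntervalIntegrable f volume a b := by
  rw [intervalIntegrable_iff]
  refine ⟨hf, HasFiniteIntegral.restrict_of_bounded (C := K) (by simp [uIoc]) ?_⟩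
  filter_upwards [ae_restrict_mem measurableSet_uIoc] with s hs using hK s hs

variable {X : Type*} [NormedAddCommGroup X] [NormedSpace ℝ X]

lemma norm_integral_le_of_Icc {f : ℝ → X} {h t K : ℝ} (ht : t ∈ Icc 0 h) (hK : 0 ≤ K)
    (hf : ∀ s ∈ Icc 0 h, ‖f s‖ ≤ K) : ‖∫ s in (0 : ℝ)..t, f s‖ ≤ h * K := by
  have h1 := intervalIntegral.norm_integral_le_of_norm_le_const (a := (0 : ℝ)) (b := t) (f := f)
    (C := K) (fun s hs ↦ by
      rw [uIoc_of_le ht.1] at hs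
      exact hf s ⟨hs.1.le, hs.2.trans ht.2⟩)
  rw [sub_zero, abs_of_nonneg ht.1] at h1
  nlinarith [ht.1, ht.2]

/-- Picard iteration: `C * h ≤ 1 / 2` makes the integral operator a `1/2`-contraction. Only
measurability in time is required, and the space is general because the lemma serves both the
equation itself and its operator-valued linearization. -/
lemma exists_integral_eq [CompleteSpace X] {g : ℝ → X → X} {C : ℝ≥0} {B h : ℝ} (hh : 0 ≤ h)
    (hC : C * h ≤ 1 / 2) (hg : ∀ s, LipschitzWith C (g s)) (hB : ∀ s, ‖g s 0‖ ≤ B)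
    (hm : ∀ ξ : ℝ → X, Continuous ξ → StronglyMeasurable fun s ↦ g s (ξ s)) (z : X) :
    ∃ ξ : ℝ → X, Continuous ξ ∧ ∀ t ∈ Icc 0 h, ξ t = z + ∫ s in (0 : ℝ)..t, g s (ξ s) := by
  have bound : ∀ (ξ : BoundedContinuousFunction ℝ X) s, ‖g s (ξ s)‖ ≤ B + C * ‖ξ‖ := by
    intro ξ s
    have h1 := (hg s).dist_le_mul (ξ s) 0
    rw [dist_eq_norm, dist_zero_right] at h1
    have h2 := norm_le_norm_add_norm_sub' (g s (ξ s)) (g s 0)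
    have h3 : (C : ℝ) * ‖ξ s‖ ≤ C * ‖ξ‖ := by gcongr; exact ξ.norm_coe_le_norm s
    linarith [hB s]
  have int : ∀ (ξ : BoundedContinuousFunction ℝ X) a b,
      IntervalIntegrable (fun s ↦ g s (ξ s)) volume a b := fun ξ a b ↦
    intervalIntegrable_of_bound (hm ξ ξ.continuous).aestronglyMeasurable (fun s _ ↦ bound ξ s)
  -- Clamping time to `[0, h]` lets the operator act on the complete space of bounded continuous
  -- functions on all of `ℝ`; the clamp is invisible on `[0, h]`.
  let c : ℝ → ℝ := fun t ↦ max 0 (min h t)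
  have hc : ∀ t, c t ∈ Icc 0 h := fun t ↦ ⟨le_max_left _ _, max_le hh (min_le_left _ _)⟩
  have hcc : Continuous c := by fun_prop
  let K : BoundedContinuousFunction ℝ X → BoundedContinuousFunction ℝ X := fun ξ ↦
    BoundedContinuousFunction.ofNormedAddCommGroup
      (fun t ↦ z + ∫ s in (0 : ℝ)..c t, g s (ξ s))
      (continuous_const.add ((intervalIntegral.continuous_primitive (int ξ) 0).comp hcc))
      (‖z‖ + h * (B + C * ‖ξ‖)) (fun t ↦ (norm_add_le _ _).trans (by
        gcongr
        exact norm_integral_le_of_Icc (hc t) ((norm_nonneg _).trans (bound ξ 0))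
          (fun s _ ↦ bound ξ s)))
  have hK : ContractingWith (1 / 2) K := by
    refine ⟨by norm_num, LipschitzWith.of_dist_le_mul fun ξ η ↦ ?_⟩
    rw [BoundedContinuousFunction.dist_le (by positivity)]
    intro t
    change dist (z + ∫ s in (0 : ℝ)..c t, g s (ξ s)) (z + ∫ s in (0 : ℝ)..c t, g s (η s)) ≤ _
    rw [dist_add_left, dist_eq_norm, ← intervalIntegral.integral_sub (int ξ _ _) (int η _ _)]
    refine (norm_integral_le_of_Icc (hc t) (K := C * dist ξ η) (by positivity)
      fun s _ ↦ ?_).trans ?_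
    · rw [← dist_eq_norm]
      refine ((hg s).dist_le_mul _ _).trans ?_
      gcongr
      exact BoundedContinuousFunction.dist_coe_le_dist s
    · have := dist_nonneg (x := ξ) (y := η)
      push_cast
      nlinarith
  refine ⟨(ContractingWith.fixedPoint K hK : BoundedContinuousFunction ℝ X),
    (ContractingWith.fixedPoint K hK).continuous, fun t ht ↦ ?_⟩
  have h1 : (ContractingWith.fixedPoint K hK) t = K (ContractingWith.fixedPoint K hK) t :=
    congrArg (fun ξ : BoundedContinuousFunction ℝ X ↦ ξ t) hK.fixedPoint_isFixedPt.symm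
  have h2 : c t = t := by simp [c, ht.1, ht.2]
  conv_lhs => rw [h1]
  change z + ∫ s in (0 : ℝ)..c t, _ = _
  rw [h2]

end Caratheodory

/-! ### Differentiability of flows driven by measurable controls -/

section Flow

open Filter

variable {P : Type*} [TopologicalSpace P]
  {E : Type*} [NormedAddCommGroup E] [NormedSpace ℝ E]

/-- A continuous family of bounded `C¹` vector fields with bounded derivatives. -/
structure IsBoundedC1Family (H : P → E → E) (H' : P → E → E →L[ℝ] E) (C : ℝ≥0) : Prop where
  continuous : Continuous fun q : P × E ↦ H q.1 q.2
  continuous_deriv : Continuous fun q : P × E ↦ H' q.1 q.2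
  hasFDerivAt : ∀ p z, HasFDerivAt (H p) (H' p z) z
  norm_le : ∀ p z, ‖H p z‖ ≤ C
  norm_deriv_le : ∀ p z, ‖H' p z‖ ≤ C

variable {H : P → E → E} {H' : P → E → E →L[ℝ] E} {C : ℝ≥0} {u : ℝ → P} {h : ℝ}

namespace IsBoundedC1Family

lemma lipschitzWith (hH : IsBoundedC1Family H H' C) (p : P) : LipschitzWith C (H p) :=
  lipschitzWith_of_nnnorm_fderiv_le (𝕜 := ℝ) (fun z ↦ (hH.hasFDerivAt p z).differentiableAt)
    (fun z ↦ by rw [(hH.hasFDerivAt p z).fderiv]; exact hH.norm_deriv_le p z)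

lemma neg (hH : IsBoundedC1Family H H' C) :
    IsBoundedC1Family (fun p z ↦ -H p z) (fun p z ↦ -H' p z) C where
  continuous := hH.continuous.neg
  continuous_deriv := hH.continuous_deriv.neg
  hasFDerivAt p z := (hH.hasFDerivAt p z).neg
  norm_le p z := by rw [norm_neg]; exact hH.norm_le p z
  norm_deriv_le p z := by rw [norm_neg]; exact hH.norm_deriv_le p z

lemma stronglyMeasurable_comp (hH : IsBoundedC1Family H H' C) (hu : StronglyMeasurable u)
    {ξ : ℝ → E} (hξ : StronglyMeasurable ξ) : StronglyMeasurable fun s ↦ H (u s) (ξ s) :=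
  hH.continuous.comp_stronglyMeasurable (hu.prodMk hξ)

lemma stronglyMeasurable_deriv_comp (hH : IsBoundedC1Family H H' C) (hu : StronglyMeasurable u)
    {ξ : ℝ → E} (hξ : StronglyMeasurable ξ) : StronglyMeasurable fun s ↦ H' (u s) (ξ s) :=
  hH.continuous_deriv.comp_stronglyMeasurable (hu.prodMk hξ)

lemma intervalIntegrable (hH : IsBoundedC1Family H H' C) (hu : StronglyMeasurable u)
    {ξ : ℝ → E} {a b : ℝ} (hξ : AEStronglyMeasurable ξ (volume.restrict (uIoc a b))) :
    IntervalIntegrable (fun s ↦ H (u s) (ξ s)) volume a b :=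
  intervalIntegrable_of_bound
    (hH.continuous.comp_aestronglyMeasurable (hu.aestronglyMeasurable.prodMk hξ))
    fun _ _ ↦ hH.norm_le _ _

/-- Two solutions on a short interval are at distance controlled by the initial distance. -/
lemma norm_sub_le (hH : IsBoundedC1Family H H' C) (hu : StronglyMeasurable u)
    (hC : C * h ≤ 1 / 4) {ξ η : ℝ → E} {z w : E}
    (hξ : ContinuousOn ξ (Icc 0 h)) (hη : ContinuousOn η (Icc 0 h))
    (hξ' : ∀ t ∈ Icc 0 h, ξ t = z + ∫ s in (0 : ℝ)..t, H (u s) (ξ s))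
    (hη' : ∀ t ∈ Icc 0 h, η t = w + ∫ s in (0 : ℝ)..t, H (u s) (η s)) :
    ∀ t ∈ Icc 0 h, ‖ξ t - η t‖ ≤ 2 * ‖z - w‖ := by
  -- As `C * h ≤ 1 / 4`, the integral contributes at most half of any bound `K`, so absorption plays
  -- the role of Gronwall's inequality.
  refine le_two_mul_of_forall_bound (by fun_prop) fun K hK t ht ↦ ?_
  have hsub : uIoc 0 t ⊆ Icc 0 h := by
    rw [uIoc_of_le ht.1]; exact fun s hs ↦ ⟨hs.1.le, hs.2.trans ht.2⟩
  have hK0 : 0 ≤ K := (norm_nonneg _).trans (hK t ht)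
  have i1 : IntervalIntegrable (fun s ↦ H (u s) (ξ s)) volume 0 t :=
    hH.intervalIntegrable hu ((hξ.mono hsub).aestronglyMeasurable measurableSet_uIoc)
  have i2 : IntervalIntegrable (fun s ↦ H (u s) (η s)) volume 0 t :=
    hH.intervalIntegrable hu ((hη.mono hsub).aestronglyMeasurable measurableSet_uIoc)
  rw [hξ' t ht, hη' t ht, add_sub_add_comm, ← intervalIntegral.integral_sub i1 i2]
  refine (norm_add_le _ _).trans ?_
  gcongr
  refine (norm_integral_le_of_Icc ht (K := C * K) (by positivity) fun s hs ↦ ?_).trans ?_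
  · rw [← dist_eq_norm]
    refine ((hH.lipschitzWith _).dist_le_mul _ _).trans ?_
    rw [dist_eq_norm]
    gcongr
    exact hK s hs
  · nlinarith

lemma eqOn (hH : IsBoundedC1Family H H' C) (hu : StronglyMeasurable u)
    (hC : C * h ≤ 1 / 4) {ξ η : ℝ → E} {z : E}
    (hξ : ContinuousOn ξ (Icc 0 h)) (hη : ContinuousOn η (Icc 0 h))
    (hξ' : ∀ t ∈ Icc 0 h, ξ t = z + ∫ s in (0 : ℝ)..t, H (u s) (ξ s))
    (hη' : ∀ t ∈ Icc 0 h, η t = z + ∫ s in (0 : ℝ)..t, H (u s) (η s)) :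
    EqOn ξ η (Icc 0 h) := fun t ht ↦ by
  simpa [sub_eq_zero] using hH.norm_sub_le hu hC hξ hη hξ' hη' t ht

/-- The variational equation along a solution. -/
lemma exists_variational [CompleteSpace E] (hH : IsBoundedC1Family H H' C)
    (hu : StronglyMeasurable u) (hh : 0 ≤ h) (hC : C * h ≤ 1 / 4) {ξ : ℝ → E}
    (hξ : Continuous ξ) :
    ∃ A : ℝ → E →L[ℝ] E, Continuous A ∧
      (∀ t ∈ Icc 0 h, A t = ContinuousLinearMap.id ℝ E +
        ∫ s in (0 : ℝ)..t, (H' (u s) (ξ s)).comp (A s)) ∧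
      ∀ t ∈ Icc 0 h, ‖A t‖ ≤ 2 := by
  obtain ⟨A, hA, hA'⟩ := exists_integral_eq (X := E →L[ℝ] E)
    (g := fun s B ↦ (H' (u s) (ξ s)).comp B) (C := C) (B := 0) hh (by linarith)
    (fun s ↦ LipschitzWith.of_dist_le_mul fun B B' ↦ by
      rw [dist_eq_norm, dist_eq_norm, ← ContinuousLinearMap.comp_sub]
      refine (ContinuousLinearMap.opNorm_comp_le _ _).trans ?_
      gcongr
      exact hH.norm_deriv_le _ _)
    (fun s ↦ by simp)
    (fun η hη ↦ by
      have h1 := hH.stronglyMeasurable_deriv_comp hu hξ.stronglyMeasurable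
      have h2 : Continuous fun q : (E →L[ℝ] E) × (E →L[ℝ] E) ↦ q.1.comp q.2 := by fun_prop
      exact h2.comp_stronglyMeasurable (h1.prodMk hη.stronglyMeasurable))
    (ContinuousLinearMap.id ℝ E)
  refine ⟨A, hA, hA', fun t ht ↦ ?_⟩
  have := le_two_mul_of_forall_bound (e := fun t ↦ ‖A t‖) (h := h) (δ := 1) (by fun_prop)
    (fun K hK t ht ↦ by
      have hK0 : 0 ≤ K := (norm_nonneg _).trans (hK t ht)
      rw [hA' t ht]
      refine (norm_add_le _ _).trans ?_
      refine add_le_add ContinuousLinearMap.norm_id_le ?_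
      refine (norm_integral_le_of_Icc ht (K := C * K) (by positivity) fun s hs ↦ ?_).trans ?_
      · refine (ContinuousLinearMap.opNorm_comp_le _ _).trans ?_
        gcongr
        · exact hH.norm_deriv_le _ _
        · exact hK s hs
      · nlinarith) t ht
  linarith

/-- Short-time flows of Carathéodory families are `C¹` with injective derivative. -/
theorem exists_flow [CompleteSpace E] (hH : IsBoundedC1Family H H' C)
    (hu : StronglyMeasurable u) (hh : 0 ≤ h) (hC : C * h ≤ 1 / 4) :
    ∃ ψ : E → ℝ → E, (∀ z, Continuous (ψ z)) ∧
      (∀ z, ∀ t ∈ Icc 0 h, ψ z t = z + ∫ s in (0 : ℝ)..t, H (u s) (ψ z s)) ∧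
      (∀ t ∈ Icc 0 h, ∀ z w, ‖ψ z t - ψ w t‖ ≤ 2 * ‖z - w‖) ∧
      (∀ t ∈ Icc 0 h, ContDiff ℝ 1 fun z ↦ ψ z t) ∧
      ∀ t ∈ Icc 0 h, ∀ z, Function.Injective (fderiv ℝ (fun z ↦ ψ z t) z) := by
  have ex : ∀ z, ∃ ξ : ℝ → E, Continuous ξ ∧
      ∀ t ∈ Icc 0 h, ξ t = z + ∫ s in (0 : ℝ)..t, H (u s) (ξ s) :=
    exists_integral_eq (C := C) (B := C) hh (by linarith) (fun s ↦ hH.lipschitzWith _)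
      (fun s ↦ hH.norm_le _ _)
      (fun ξ hξ ↦ hH.stronglyMeasurable_comp hu hξ.stronglyMeasurable)
  choose ψ hψ hψ' using ex
  choose A hA hA' hA2 using fun z ↦ hH.exists_variational hu hh hC (hψ z)
  have lip : ∀ t ∈ Icc 0 h, ∀ z w, ‖ψ z t - ψ w t‖ ≤ 2 * ‖z - w‖ := fun t ht z w ↦
    hH.norm_sub_le hu hC (hψ z).continuousOn (hψ w).continuousOn (hψ' z) (hψ' w) t ht
  have cont : ∀ t ∈ Icc 0 h, Continuous fun z ↦ ψ z t := fun t ht ↦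
    (LipschitzWith.of_dist_le_mul (K := 2) fun z w ↦ by
      simpa [dist_eq_norm] using lip t ht z w).continuous
  have mψ : ∀ z, StronglyMeasurable (ψ z) := fun z ↦ (hψ z).stronglyMeasurable
  have mD := fun z ↦ hH.stronglyMeasurable_deriv_comp hu (mψ z)
  have mF := fun z ↦ hH.stronglyMeasurable_comp hu (mψ z)
  have iF : ∀ z a b, IntervalIntegrable (fun s ↦ H (u s) (ψ z s)) volume a b := fun z a b ↦
    hH.intervalIntegrable hu (mψ z).aestronglyMeasurable
  have mDA : ∀ z, StronglyMeasurable fun s ↦ (H' (u s) (ψ z s)).comp (A z s) := fun z ↦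
    (show Continuous fun q : (E →L[ℝ] E) × (E →L[ℝ] E) ↦ q.1.comp q.2 by
      fun_prop).comp_stronglyMeasurable ((mD z).prodMk (hA z).stronglyMeasurable)
  have iDA : ∀ z, ∀ t ∈ Icc 0 h,
      IntervalIntegrable (fun s ↦ (H' (u s) (ψ z s)).comp (A z s)) volume 0 t := fun z t ht ↦
    intervalIntegrable_of_bound (K := C * 2) (mDA z).aestronglyMeasurable fun s hs ↦ by
      rw [uIoc_of_le ht.1] at hs
      refine (ContinuousLinearMap.opNorm_comp_le _ _).trans ?_
      gcongr
      · exact hH.norm_deriv_le _ _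
      · exact hA2 z s ⟨hs.1.le, hs.2.trans ht.2⟩
  have deriv : ∀ t ∈ Icc 0 h, ∀ z, HasFDerivAt (fun z ↦ ψ z t) (A z t) z := by
    intro t₀ ht₀ z
    -- `r w s` is the first-order Taylor remainder of `H (u s)` at `ψ z s`. The error `ψ w - ψ z - A
    -- z (w - z)` solves the variational equation forced by `r`, so absorption bounds it by the
    -- integral of `‖r‖`.
    let r : E → ℝ → E := fun w s ↦ H (u s) (ψ w s) - H (u s) (ψ z s) -
      H' (u s) (ψ z s) (ψ w s - ψ z s)
    have mr : ∀ w, StronglyMeasurable (r w) := fun w ↦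
      ((mF w).sub (mF z)).sub ((show Continuous fun q : (E →L[ℝ] E) × E ↦ q.1 q.2 by
        fun_prop).comp_stronglyMeasurable ((mD z).prodMk ((mψ w).sub (mψ z))))
    have br : ∀ w, ∀ s ∈ Icc 0 h, ‖r w s‖ ≤ 4 * C * ‖w - z‖ := by
      intro w s hs
      have h1 := (hH.lipschitzWith (u s)).dist_le_mul (ψ w s) (ψ z s)
      rw [dist_eq_norm, dist_eq_norm] at h1
      have h2 := (H' (u s) (ψ z s)).le_of_opNorm_le (hH.norm_deriv_le _ _) (ψ w s - ψ z s)
      have h3 : (C : ℝ) * ‖ψ w s - ψ z s‖ ≤ C * (2 * ‖w - z‖) := by gcongr; exact lip s hs w z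
      refine (_root_.norm_sub_le _ _).trans ?_
      linarith
    have ir : ∀ w, ∀ t ∈ Icc 0 h, IntervalIntegrable (r w) volume 0 t := fun w t ht ↦
      intervalIntegrable_of_bound (mr w).aestronglyMeasurable fun s hs ↦ br w s (by
        rw [uIoc_of_le ht.1] at hs
        exact ⟨hs.1.le, hs.2.trans ht.2⟩)
    have hr : ∀ w, ∀ t ∈ Icc 0 h, ‖∫ s in (0 : ℝ)..t, r w s‖ ≤ ∫ s in (0 : ℝ)..h, ‖r w s‖ := by
      intro w t ht
      refine (intervalIntegral.norm_integral_le_integral_norm ht.1).trans ?_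
      exact intervalIntegral.integral_mono_interval le_rfl ht.1 ht.2
        (Eventually.of_forall fun s ↦ norm_nonneg _) (ir w h ⟨hh, le_rfl⟩).norm
    have key : ∀ w, ‖ψ w t₀ - ψ z t₀ - A z t₀ (w - z)‖ ≤ 2 * ∫ s in (0 : ℝ)..h, ‖r w s‖ := by
      intro w
      refine le_two_mul_of_forall_bound
        (e := fun t ↦ ‖ψ w t - ψ z t - A z t (w - z)‖) ?_ (fun K hK t ht ↦ ?_) t₀ ht₀
      · have := hψ w
        have := hψ z
        have := hA z
        fun_prop
      · have hK0 : 0 ≤ K := (norm_nonneg _).trans (hK t ht)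
        have e1 : (A z t) (w - z) = (w - z) +
            ∫ s in (0 : ℝ)..t, H' (u s) (ψ z s) (A z s (w - z)) := by
          conv_lhs => rw [hA' z t ht]
          rw [_root_.add_apply, ContinuousLinearMap.intervalIntegral_apply
            (iDA z t ht)]
          rfl
        have i3 : IntervalIntegrable (fun s ↦ H' (u s) (ψ z s) (A z s (w - z))) volume 0 t :=
          
          ⟨(iDA z t ht).1.apply_continuousLinearMap _, (iDA z t ht).2.apply_continuousLinearMap _⟩
        have i4 : IntervalIntegrable
            (fun s ↦ H' (u s) (ψ z s) (ψ w s - ψ z s - A z s (w - z))) volume 0 t := by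
          have := (((iF w 0 t).sub (iF z 0 t)).sub i3).sub (ir w t ht)
          refine this.congr fun s _ ↦ ?_
          simp only [r, map_sub]
          abel
        have e2 : ψ w t - ψ z t - A z t (w - z) = (∫ s in (0 : ℝ)..t, r w s) +
            ∫ s in (0 : ℝ)..t, H' (u s) (ψ z s) (ψ w s - ψ z s - A z s (w - z)) := by
          rw [← intervalIntegral.integral_add (ir w t ht) i4, e1, hψ' w t ht, hψ' z t ht]
          have : ∀ a b : E, (w + a) - (z + b) - ((w - z) + (∫ s in (0 : ℝ)..t,
              H' (u s) (ψ z s) (A z s (w - z)))) =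
              a - b - ∫ s in (0 : ℝ)..t, H' (u s) (ψ z s) (A z s (w - z)) := by
            intro a b; abel
          rw [this, ← intervalIntegral.integral_sub (iF w 0 t) (iF z 0 t),
            ← intervalIntegral.integral_sub ((iF w 0 t).sub (iF z 0 t)) i3]
          refine intervalIntegral.integral_congr fun s _ ↦ ?_
          simp only [r, map_sub]
          abel
        rw [e2]
        refine (norm_add_le _ _).trans (add_le_add (hr w t ht) ?_)
        refine (norm_integral_le_of_Icc ht (K := C * K) (by positivity) fun s hs ↦ ?_).trans ?_
        · refine (ContinuousLinearMap.le_of_opNorm_le _ (hH.norm_deriv_le _ _) _).trans ?_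
          gcongr
          exact hK s hs
        · nlinarith
    -- The remainder is `o(‖w - z‖)` for each `s`, without uniformity in `s`. The bound `4 * C` on
    -- the quotient allows dominated convergence instead.
    have lim : Tendsto (fun w ↦ ∫ s in (0 : ℝ)..h, ‖w - z‖⁻¹ * ‖r w s‖) (𝓝 z)
        (𝓝 (∫ s in (0 : ℝ)..h, 0)) := by
      refine intervalIntegral.tendsto_integral_filter_of_dominated_convergence
        (fun _ ↦ 4 * C) (Eventually.of_forall fun w ↦
          ((mr w).norm.const_mul _).aestronglyMeasurable)
        (Eventually.of_forall fun w ↦ Eventually.of_forall fun s hs ↦ ?_)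
        (by simp) (Eventually.of_forall fun s hs ↦ ?_)
      · rw [uIoc_of_le hh] at hs
        have h1 := br w s ⟨hs.1.le, hs.2⟩
        rw [norm_mul, norm_inv, norm_norm, norm_norm]
        rcases eq_or_ne ‖w - z‖ 0 with h0 | h0
        · simp [h0]
        · have : 0 < ‖w - z‖ := lt_of_le_of_ne (norm_nonneg _) h0.symm
          rw [inv_mul_le_iff₀ this]
          linarith
      · rw [uIoc_of_le hh] at hs
        have hs' : s ∈ Icc 0 h := ⟨hs.1.le, hs.2⟩
        have h1 : (fun w ↦ r w s) =o[𝓝 z] fun w ↦ ψ w s - ψ z s :=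
          ((hH.hasFDerivAt (u s) (ψ z s)).isLittleO).comp_tendsto (cont s hs').continuousAt
        have h2 : (fun w ↦ ψ w s - ψ z s) =O[𝓝 z] fun w ↦ w - z :=
          Asymptotics.IsBigO.of_bound 2 (Eventually.of_forall fun w ↦ lip s hs' w z)
        have h3 := (h1.trans_isBigO h2).norm_norm
        rw [Asymptotics.isLittleO_iff_tendsto (by
          intro w hw
          rw [norm_eq_zero, sub_eq_zero] at hw
          simp [r, hw])] at h3
        refine h3.congr fun w ↦ ?_
        rw [div_eq_inv_mul]
    rw [hasFDerivAt_iff_tendsto]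
    rw [intervalIntegral.integral_zero] at lim
    refine squeeze_zero (fun w ↦ by positivity) (fun w ↦ ?_)
      (by simpa [intervalIntegral.integral_const_mul] using lim.const_mul 2)
    have := mul_le_mul_of_nonneg_left (key w) (inv_nonneg.2 (norm_nonneg (w - z)))
    linarith
  have contA : ∀ t ∈ Icc 0 h, Continuous fun z ↦ A z t := by
    intro t₀ ht₀
    rw [continuous_iff_continuousAt]
    intro z
    have mS : ∀ w, StronglyMeasurable fun s ↦ H' (u s) (ψ w s) - H' (u s) (ψ z s) := fun w ↦
      (mD w).sub (mD z)
    have bS : ∀ w s, ‖H' (u s) (ψ w s) - H' (u s) (ψ z s)‖ ≤ C + C := fun w s ↦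
      (_root_.norm_sub_le _ _).trans (add_le_add (hH.norm_deriv_le _ _) (hH.norm_deriv_le _ _))
    have iS : ∀ w a b, IntervalIntegrable (fun s ↦ H' (u s) (ψ w s) - H' (u s) (ψ z s))
        volume a b := fun w a b ↦
      intervalIntegrable_of_bound (mS w).aestronglyMeasurable fun s _ ↦ bS w s
    -- The inner factor `2` is the bound on `‖A w‖`; the outer one comes from absorption.
    have key : ∀ w, ‖A w t₀ - A z t₀‖ ≤
        2 * (2 * ∫ s in (0 : ℝ)..h, ‖H' (u s) (ψ w s) - H' (u s) (ψ z s)‖) := by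
      intro w
      refine le_two_mul_of_forall_bound (e := fun t ↦ ‖A w t - A z t‖)
        (((hA w).sub (hA z)).norm.continuousOn) (fun K hK t ht ↦ ?_) t₀ ht₀
      have hK0 : 0 ≤ K := (norm_nonneg _).trans (hK t ht)
      have iT : IntervalIntegrable (fun s ↦ 2 * ‖H' (u s) (ψ w s) - H' (u s) (ψ z s)‖ + C * K)
          volume 0 h := ((iS w 0 h).norm.const_mul 2).add (by simp)
      rw [hA' w t ht, hA' z t ht, add_sub_add_left_eq_sub,
        ← intervalIntegral.integral_sub (iDA w t ht) (iDA z t ht)]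
      calc _ ≤ ∫ s in (0 : ℝ)..t, (2 * ‖H' (u s) (ψ w s) - H' (u s) (ψ z s)‖ + C * K) := by
            refine intervalIntegral.norm_integral_le_of_norm_le ht.1
              (Eventually.of_forall fun s hs ↦ ?_) (iT.mono_set ?_)
            · have hs' : s ∈ Icc 0 h := ⟨hs.1.le, hs.2.trans ht.2⟩
              have : (H' (u s) (ψ w s)).comp (A w s) - (H' (u s) (ψ z s)).comp (A z s) =
                  (H' (u s) (ψ w s) - H' (u s) (ψ z s)).comp (A w s) +
                    (H' (u s) (ψ z s)).comp (A w s - A z s) := by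
                rw [ContinuousLinearMap.sub_comp, ContinuousLinearMap.comp_sub]; abel
              rw [this, mul_comm 2]
              refine (norm_add_le _ _).trans (add_le_add ?_ ?_)
              · refine (ContinuousLinearMap.opNorm_comp_le _ _).trans ?_
                gcongr
                exact hA2 w s hs'
              · refine (ContinuousLinearMap.opNorm_comp_le _ _).trans ?_
                gcongr
                · exact hH.norm_deriv_le _ _
                · exact hK s hs'
            · rw [uIcc_of_le ht.1, uIcc_of_le hh]
              exact Icc_subset_Icc le_rfl ht.2
        _ ≤ ∫ s in (0 : ℝ)..h, (2 * ‖H' (u s) (ψ w s) - H' (u s) (ψ z s)‖ + C * K) :=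
            intervalIntegral.integral_mono_interval le_rfl ht.1 ht.2
              (Eventually.of_forall fun s ↦ by positivity) iT
        _ ≤ _ := by
            rw [intervalIntegral.integral_add ((iS w 0 h).norm.const_mul 2) (by simp),
              intervalIntegral.integral_const_mul, intervalIntegral.integral_const]
            simp only [sub_zero, smul_eq_mul]
            nlinarith
    have lim : Tendsto (fun w ↦ ∫ s in (0 : ℝ)..h, ‖H' (u s) (ψ w s) - H' (u s) (ψ z s)‖) (𝓝 z)
        (𝓝 (∫ s in (0 : ℝ)..h, 0)) := by
      refine intervalIntegral.tendsto_integral_filter_of_dominated_convergence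
        (fun _ ↦ C + C) (Eventually.of_forall fun w ↦ (mS w).norm.aestronglyMeasurable)
        (Eventually.of_forall fun w ↦ Eventually.of_forall fun s _ ↦ by
          rw [norm_norm]; exact bS w s)
        (by simp) (Eventually.of_forall fun s hs ↦ ?_)
      rw [uIoc_of_le hh] at hs
      have h1 : Continuous fun w ↦ ‖H' (u s) (ψ w s) - H' (u s) (ψ z s)‖ :=
        ((hH.continuous_deriv.comp (continuous_const.prodMk
          (cont s ⟨hs.1.le, hs.2⟩))).sub continuous_const).norm
      simpa using h1.tendsto z
    rw [intervalIntegral.integral_zero] at lim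
    rw [ContinuousAt, tendsto_iff_norm_sub_tendsto_zero]
    exact squeeze_zero (fun w ↦ norm_nonneg _) key
      (by simpa using (lim.const_mul 2).const_mul 2)
  refine ⟨ψ, hψ, hψ', lip, fun t ht ↦ ?_, fun t ht z ↦ ?_⟩
  · rw [contDiff_one_iff_fderiv]
    refine ⟨fun z ↦ (deriv t ht z).differentiableAt, ?_⟩
    have : fderiv ℝ (fun z ↦ ψ z t) = fun z ↦ A z t := funext fun z ↦ (deriv t ht z).fderiv
    rw [this]
    exact contA t ht
  · rw [(deriv t ht z).fderiv]
    -- With `‖A z s‖ ≤ 2` the integral is at most `2 * C * h ≤ 1 / 2`. A map this close to the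
    -- identity has no kernel.
    have h1 : ‖A z t - ContinuousLinearMap.id ℝ E‖ ≤ 1 / 2 := by
      conv_lhs => rw [hA' z t ht, add_sub_cancel_left]
      refine (norm_integral_le_of_Icc ht (K := C * 2) (by positivity) fun s hs ↦ ?_).trans
        (by linarith)
      refine (ContinuousLinearMap.opNorm_comp_le _ _).trans ?_
      gcongr
      · exact hH.norm_deriv_le _ _
      · exact hA2 z s hs
    rw [injective_iff_map_eq_zero]
    intro w hw
    have h2 := (A z t - ContinuousLinearMap.id ℝ E).le_of_opNorm_le h1 w
    simp only [_root_.sub_apply, hw, ContinuousLinearMap.id_apply, zero_sub,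
      norm_neg] at h2
    have := norm_nonneg w
    exact norm_eq_zero.1 (by linarith)

end IsBoundedC1Family

end Flow

/-! ### Absolutely continuous functions: gluing, translation, recovery from the derivative -/

section AbsolutelyContinuous

open AbsolutelyContinuousOnInterval

variable {X : Type*} [PseudoMetricSpace X]

lemma absolutelyContinuousOnInterval_congr {f g : ℝ → X} {a b : ℝ}
    (hf : AbsolutelyContinuousOnInterval f a b) (h : EqOn f g (uIcc a b)) :
    AbsolutelyContinuousOnInterval g a b := by
  rw [absolutelyContinuousOnInterval_iff] at hf ⊢
  intro ε hε
  obtain ⟨δ, hδ, H⟩ := hf ε hε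
  refine ⟨δ, hδ, fun E hE hE' ↦ ?_⟩
  convert H E hE hE' using 1
  refine Finset.sum_congr rfl fun i hi ↦ ?_
  rw [h (hE.1 i hi).1, h (hE.1 i hi).2]

lemma absolutelyContinuousOnInterval_trans {f : ℝ → X} {a b c : ℝ} (hac : a ≤ c) (hcb : c ≤ b)
    (h₁ : AbsolutelyContinuousOnInterval f a c) (h₂ : AbsolutelyContinuousOnInterval f c b) :
    AbsolutelyContinuousOnInterval f a b := by
  rw [absolutelyContinuousOnInterval_iff] at h₁ h₂ ⊢
  intro ε hε
  obtain ⟨δ₁, hδ₁, H₁⟩ := h₁ (ε / 2) (half_pos hε)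
  obtain ⟨δ₂, hδ₂, H₂⟩ := h₂ (ε / 2) (half_pos hε)
  refine ⟨min δ₁ δ₂, lt_min hδ₁ hδ₂, fun E hE hlen ↦ ?_⟩
  have hmem : ∀ i ∈ Finset.range E.1, (E.2 i).1 ∈ Icc a b ∧ (E.2 i).2 ∈ Icc a b := fun i hi ↦ by
    have := hE.1 i hi
    rwa [uIcc_of_le (hac.trans hcb)] at this
  -- Each interval is cut at `c` by `min` and `max`; the pieces remain disjoint and no length
  -- increases. An interval lying on one side degenerates to the point `c` on the other.
  let E₁ : ℕ × (ℕ → ℝ × ℝ) := (E.1, fun i ↦ (min (E.2 i).1 c, min (E.2 i).2 c))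
  let E₂ : ℕ × (ℕ → ℝ × ℝ) := (E.1, fun i ↦ (max (E.2 i).1 c, max (E.2 i).2 c))
  have k₁ : E₁ ∈ disjWithin a c := by
    refine ⟨fun i hi ↦ ?_, fun i hi j hj hij ↦ ?_⟩
    · rw [uIcc_of_le hac]
      exact ⟨⟨le_min (hmem i hi).1.1 hac, min_le_right _ _⟩,
        ⟨le_min (hmem i hi).2.1 hac, min_le_right _ _⟩⟩
    · refine (hE.2 hi hj hij).mono ?_ ?_ <;>
      · intro x hx
        simp only [E₁, mem_uIoc] at hx ⊢
        grind
  have k₂ : E₂ ∈ disjWithin c b := by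
    refine ⟨fun i hi ↦ ?_, fun i hi j hj hij ↦ ?_⟩
    · rw [uIcc_of_le hcb]
      exact ⟨⟨le_max_right _ _, max_le (hmem i hi).1.2 hcb⟩,
        ⟨le_max_right _ _, max_le (hmem i hi).2.2 hcb⟩⟩
    · refine (hE.2 hi hj hij).mono ?_ ?_ <;>
      · intro x hx
        simp only [E₂, mem_uIoc] at hx ⊢
        grind
  have l₁ : ∑ i ∈ Finset.range E₁.1, dist (E₁.2 i).1 (E₁.2 i).2 < δ₁ := by
    refine lt_of_le_of_lt (Finset.sum_le_sum fun i _ ↦ ?_) (hlen.trans_le (min_le_left _ _))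
    simp only [E₁, Real.dist_eq]
    refine (abs_min_sub_min_le_max _ _ _ _).trans ?_
    simp
  have l₂ : ∑ i ∈ Finset.range E₂.1, dist (E₂.2 i).1 (E₂.2 i).2 < δ₂ := by
    refine lt_of_le_of_lt (Finset.sum_le_sum fun i _ ↦ ?_) (hlen.trans_le (min_le_right _ _))
    simp only [E₂, Real.dist_eq]
    refine (abs_max_sub_max_le_max _ _ _ _).trans ?_
    simp
  have key : ∀ x y : ℝ, dist (f x) (f y) ≤
      dist (f (min x c)) (f (min y c)) + dist (f (max x c)) (f (max y c)) := by
    intro x y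
    rcases le_total x c with hx | hx <;> rcases le_total y c with hy | hy
    · simp [hx, hy]
    · simpa [hx, hy] using dist_triangle (f x) (f c) (f y)
    · have := dist_triangle (f x) (f c) (f y)
      simp only [min_eq_right hx, min_eq_left hy, max_eq_left hx, max_eq_right hy]
      linarith
    · simp [hx, hy]
  calc _ ≤ ∑ i ∈ Finset.range E.1, (dist (f (E₁.2 i).1) (f (E₁.2 i).2) +
        dist (f (E₂.2 i).1) (f (E₂.2 i).2)) := Finset.sum_le_sum fun i _ ↦ key _ _
    _ < ε := by
      rw [Finset.sum_add_distrib]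
      linarith [H₁ E₁ k₁ l₁, H₂ E₂ k₂ l₂]

lemma absolutelyContinuousOnInterval_shift {f : ℝ → X} {a b : ℝ} (d : ℝ)
    (hf : AbsolutelyContinuousOnInterval f (a + d) (b + d)) :
    AbsolutelyContinuousOnInterval (fun t ↦ f (t + d)) a b := by
  rw [absolutelyContinuousOnInterval_iff] at hf ⊢
  intro ε hε
  obtain ⟨δ, hδ, H⟩ := hf ε hε
  refine ⟨δ, hδ, fun E hE hE' ↦
    H (E.1, fun i ↦ ((E.2 i).1 + d, (E.2 i).2 + d)) ⟨fun i hi ↦ ?_, fun i hi j hj hij ↦ ?_⟩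
      (by simpa using hE')⟩
  · have := hE.1 i hi
    simp only [mem_uIcc, add_le_add_iff_right] at this ⊢
    exact this
  · have h1 := hE.2 hi hj hij
    simp only [Function.onFun, Set.disjoint_left, mem_uIoc] at h1 ⊢
    intro x hx hx'
    refine h1 (a := x - d) ?_ ?_ <;> grind

variable {E : Type*} [NormedAddCommGroup E] [NormedSpace ℝ E]

lemma lipschitzOnWith_integral {f : ℝ → E} {C : ℝ≥0} {a b : ℝ}
    (hm : AEStronglyMeasurable f (volume.restrict (Ioc a b)))
    (hf : ∀ s ∈ Ioc a b, ‖f s‖ ≤ C) :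
    LipschitzOnWith C (fun t ↦ ∫ s in a..t, f s) (Icc a b) := by
  have int : ∀ t ∈ Icc a b, IntervalIntegrable f volume a t := fun t ht ↦ by
    have hs : uIoc a t ⊆ Ioc a b := by rw [uIoc_of_le ht.1]; exact Ioc_subset_Ioc_right ht.2
    exact intervalIntegrable_of_bound (hm.mono_measure (Measure.restrict_mono hs le_rfl))
      fun s h ↦ hf s (hs h)
  refine LipschitzOnWith.of_dist_le_mul fun x hx y hy ↦ ?_
  rw [dist_eq_norm, intervalIntegral.integral_interval_sub_left (int x hx) (int y hy)]
  rw [Real.dist_eq]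
  refine intervalIntegral.norm_integral_le_of_norm_le_const fun s hs ↦ hf s ?_
  rw [mem_uIoc] at hs
  rcases hs with hs | hs
  · exact ⟨hy.1.trans_lt hs.1, hs.2.trans hx.2⟩
  · exact ⟨hx.1.trans_lt hs.1, hs.2.trans hy.2⟩

lemma IsBoundedC1Family.lipschitzOnWith_of_integral_eq {P : Type*} [TopologicalSpace P]
    {H : P → E → E} {H' : P → E → E →L[ℝ] E} {C : ℝ≥0} (hH : IsBoundedC1Family H H' C)
    {w : ℝ → P} (hw : StronglyMeasurable w) {ξ : ℝ → E} {h : ℝ} (hξ : ContinuousOn ξ (Icc 0 h))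
    (hξ' : ∀ t ∈ Icc 0 h, ξ t = ξ 0 + ∫ s in (0 : ℝ)..t, H (w s) (ξ s)) :
    LipschitzOnWith C ξ (Icc 0 h) := by
  have h1 := lipschitzOnWith_integral (a := 0) (b := h)
    (hH.continuous.comp_aestronglyMeasurable (hw.aestronglyMeasurable.prodMk
      ((hξ.mono Ioc_subset_Icc_self).aestronglyMeasurable measurableSet_Ioc)))
    (fun s _ ↦ hH.norm_le _ _)
  refine LipschitzOnWith.of_dist_le_mul fun x hx y hy ↦ ?_
  rw [hξ' x hx, hξ' y hy, dist_add_left]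
  exact h1.dist_le_mul x hx y hy

/-- The fundamental theorem of calculus for absolutely continuous functions with bounded
derivative. -/
lemma eq_add_integral_of_ae_hasDerivAt [CompleteSpace E] {f g : ℝ → E} {C : ℝ≥0} {a b : ℝ}
    (hf : AbsolutelyContinuousOnInterval f a b)
    (hm : AEStronglyMeasurable g (volume.restrict (Ioc a b)))
    (hC : ∀ s ∈ Ioc a b, ‖g s‖ ≤ C)
    (hd : ∀ᵐ t, t ∈ Ioo a b → HasDerivAt f (g t) t) :
    ∀ t ∈ Icc a b, f t = f a + ∫ s in a..t, g s := by
  intro t ht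
  have hab : a ≤ b := ht.1.trans ht.2
  have int : IntervalIntegrable g volume a b :=
    intervalIntegrable_of_bound (K := C) (by rwa [uIoc_of_le hab]) (by rwa [uIoc_of_le hab])
  have lip := lipschitzOnWith_integral hm hC
  -- The difference between `f` and the integral of `g` is absolutely continuous with zero
  -- derivative almost everywhere, hence constant.
  have hsub := hf.fun_sub (by
    rw [← uIcc_of_le hab] at lip
    exact lip.absolutelyContinuousOnInterval)
  obtain ⟨c, hc⟩ := hsub.const_of_ae_hasDerivAt_zero (by
    have ha : ∀ᵐ x : ℝ, x ≠ a := by simp [ae_iff, measure_singleton]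
    have hb : ∀ᵐ x : ℝ, x ≠ b := by simp [ae_iff, measure_singleton]
    filter_upwards [hd, int.ae_hasDerivAt_integral, ha, hb] with x h1 h2 h3 h4 hx
    have hx' := hx
    rw [uIcc_of_le hab] at hx'
    have h5 := (h1 ⟨lt_of_le_of_ne hx'.1 (Ne.symm h3), lt_of_le_of_ne hx'.2 h4⟩).fun_sub
      (h2 hx a (by simp))
    rwa [sub_self] at h5)
  have e1 := hc t (by rwa [uIcc_of_le hab])
  have e2 := hc a (by simp)
  simp only [intervalIntegral.integral_same, sub_zero] at e2
  rw [e2, ← e1]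
  abel

end AbsolutelyContinuous

/-! ### Admissible controls: restriction and concatenation -/

section Admissible

variable {m : ℕ} {U : Set (EuclideanSpace ℝ (Fin m))} {T T₁ T₂ : ℝ}
  {u u₁ u₂ : ℝ → EuclideanSpace ℝ (Fin m)}

/-- Run `f` up to time `T`, and then `g`. -/
noncomputable def concat {X : Type*} (T : ℝ) (f g : ℝ → X) (t : ℝ) : X :=
  if t ≤ T then f t else g (t - T)

lemma concat_of_le {X : Type*} {T : ℝ} {f g : ℝ → X} {t : ℝ} (h : t ≤ T) :
    concat T f g t = f t := if_pos h

lemma concat_of_lt {X : Type*} {T : ℝ} {f g : ℝ → X} {t : ℝ} (h : T < t) :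
    concat T f g t = g (t - T) := if_neg h.not_ge

lemma concat_of_ge {X : Type*} {T : ℝ} {f g : ℝ → X} {t : ℝ} (hfg : f T = g 0) (h : T ≤ t) :
    concat T f g t = g (t - T) := by
  rcases h.eq_or_lt with rfl | h
  · rw [concat_of_le le_rfl, hfg, sub_self]
  · exact concat_of_lt h

lemma ae_Icc_shift {p : ℝ → Prop} {a b : ℝ} (ha : 0 ≤ a) (hb : b ≤ T)
    (h : ∀ᵐ t ∂volume.restrict (Icc 0 T), p t) :
    ∀ᵐ t ∂volume.restrict (Icc 0 (b - a)), p (t + a) := by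
  rw [ae_restrict_iff' measurableSet_Icc] at h ⊢
  filter_upwards [(measurePreserving_add_right volume a).quasiMeasurePreserving.ae h] with t ht h'
  exact ht ⟨by linarith [h'.1], by linarith [h'.2]⟩

/-- The junction time `T₁` is negligible, hence the strict inequalities: a concatenated curve need
not be differentiable there. -/
lemma ae_concat {p : ℝ → Prop}
    (h₁ : ∀ᵐ t ∂volume.restrict (Icc 0 T₁), t < T₁ → p t)
    (h₂ : ∀ᵐ t ∂volume.restrict (Icc 0 T₂), 0 < t → p (t + T₁)) :
    ∀ᵐ t ∂volume.restrict (Icc 0 (T₁ + T₂)), p t := by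
  rw [ae_restrict_iff' measurableSet_Icc] at h₁ h₂ ⊢
  have h₃ : ∀ᵐ x : ℝ, x ≠ T₁ := by simp [ae_iff, measure_singleton]
  filter_upwards [h₁, h₃, (measurePreserving_sub_right volume T₁).quasiMeasurePreserving.ae h₂]
    with t h1 h3 h2 ht
  rcases lt_or_gt_of_ne h3 with h | h
  · exact h1 ⟨ht.1, h.le⟩ h
  · simpa using h2 ⟨by linarith, by linarith [ht.2]⟩ (by linarith)

lemma isEssentiallyBoundedControl_iff : IsEssentiallyBoundedControl U T u ↔
    AEStronglyMeasurable u (volume.restrict (Icc 0 T)) ∧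
      ∃ R, ∀ᵐ t ∂volume.restrict (Icc 0 T), u t ∈ U ∧ ‖u t‖ ≤ R := by
  constructor
  · rintro ⟨h1, h2⟩
    refine ⟨h1.1, (eLpNorm u ∞ (volume.restrict (Icc 0 T))).toReal, ?_⟩
    filter_upwards [h2, ae_le_eLpNormEssSup (f := u) (μ := volume.restrict (Icc 0 T))] with t h h'
    refine ⟨h, ?_⟩
    rw [← eLpNorm_exponent_top] at h'
    have := ENNReal.toReal_mono h1.2.ne h'
    simpa using this
  · rintro ⟨h1, R, h2⟩
    exact ⟨memLp_top_of_bound h1 R (h2.mono fun t h ↦ h.2), h2.mono fun t h ↦ h.1⟩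

lemma IsPiecewiseConstantControl.shift {a b : ℝ} (h : IsPiecewiseConstantControl U T u)
    (ha : 0 ≤ a) (hab : a ≤ b) (hb : b ≤ T) :
    IsPiecewiseConstantControl U (b - a) fun t ↦ u (t + a) := by
  obtain ⟨hU, N, τ, hτ, h0, hN, hu⟩ := h
  -- The old subdivision is clamped to `[a, b]`; subintervals that collapse impose no condition.
  refine ⟨fun t ht ↦ hU _ ⟨by linarith [ht.1], by linarith [ht.2]⟩, N,
    fun i ↦ max a (min b (τ i)) - a, fun i j hij ↦ ?_, ?_, ?_, fun i hi ↦ ?_⟩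
  · have := hτ hij
    dsimp only
    gcongr
  · simp only [h0]
    rw [min_eq_right (ha.trans hab), max_eq_left ha, sub_self]
  · simp only [hN]
    rw [min_eq_left hb, max_eq_right hab]
  · obtain ⟨v, hv, hv'⟩ := hu i hi
    refine ⟨v, hv, fun t ht ↦ hv' _ ?_⟩
    obtain ⟨h1, h2⟩ := ht
    grind

lemma IsPiecewiseConstantControl.concat (h₁ : IsPiecewiseConstantControl U T₁ u₁)
    (h₂ : IsPiecewiseConstantControl U T₂ u₂) :
    IsPiecewiseConstantControl U (T₁ + T₂) (concat T₁ u₁ u₂) := by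
  obtain ⟨hU, N, τ, hτ, h0, hN, hu⟩ := h₁
  obtain ⟨hU', N', τ', hτ', h0', hN', hu'⟩ := h₂
  -- At the common index `N` both formulas give `T₁`, because `τ N = T₁` and `τ' 0 = 0`.
  refine ⟨fun t ht ↦ ?_, N + N', fun i ↦ if i ≤ N then τ i else T₁ + τ' (i - N),
    fun i j hij ↦ ?_, by simp [h0], ?_, fun i hi ↦ ?_⟩
  · rcases le_or_gt t T₁ with h | h
    · rw [concat_of_le h]; exact hU t ⟨ht.1, h⟩
    · rw [concat_of_lt h]; exact hU' _ ⟨by linarith, by linarith [ht.2]⟩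
  · dsimp only
    split_ifs with h1 h2
    · exact hτ hij
    · have e1 := hτ h1
      have e2 := hτ' (Nat.zero_le (j - N))
      linarith
    · omega
    · have := hτ' (Nat.sub_le_sub_right hij N)
      linarith
  · rcases Nat.eq_zero_or_pos N' with rfl | h
    · rw [← hN', h0']; simp [hN]
    · simp only
      rw [if_neg (by omega), Nat.add_sub_cancel_left, hN']
  · rcases lt_or_ge i N with h | h
    · obtain ⟨v, hv, hv'⟩ := hu i h
      refine ⟨v, hv, fun t ht ↦ ?_⟩
      simp only [if_pos h.le, if_pos (Nat.succ_le_of_lt h)] at ht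
      have : τ (i + 1) ≤ T₁ := hN ▸ hτ (Nat.succ_le_of_lt h)
      rw [concat_of_le (ht.2.le.trans this)]
      exact hv' t ht
    · obtain ⟨v, hv, hv'⟩ := hu' (i - N) (by omega)
      refine ⟨v, hv, fun t ht ↦ ?_⟩
      have e1 : (if i ≤ N then τ i else T₁ + τ' (i - N)) = T₁ + τ' (i - N) := by
        split_ifs with h'
        · obtain rfl : i = N := le_antisymm h' h
          simp [hN, h0']
        · rfl
      have e2 : i + 1 - N = i - N + 1 := by omega
      simp only [e1, if_neg (show ¬ i + 1 ≤ N by omega), e2] at ht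
      have e3 : 0 ≤ τ' (i - N) := h0' ▸ hτ' (Nat.zero_le _)
      rw [concat_of_lt (by linarith [ht.1])]
      exact hv' _ ⟨by linarith [ht.1], by linarith [ht.2]⟩

lemma IsEssentiallyBoundedControl.shift {a b : ℝ} (h : IsEssentiallyBoundedControl U T u)
    (ha : 0 ≤ a) (hb : b ≤ T) :
    IsEssentiallyBoundedControl U (b - a) fun t ↦ u (t + a) := by
  rw [isEssentiallyBoundedControl_iff] at h ⊢
  obtain ⟨hm, R, hR⟩ := h
  refine ⟨?_, R, ae_Icc_shift ha hb hR⟩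
  have h1 : MeasurePreserving (fun t : ℝ ↦ t + a) (volume.restrict ((· + a) ⁻¹' Icc a b))
      (volume.restrict (Icc a b)) :=
    (measurePreserving_add_right volume a).restrict_preimage measurableSet_Icc
  have h2 : (fun t : ℝ ↦ t + a) ⁻¹' Icc a b = Icc 0 (b - a) := by simp
  rw [h2] at h1
  exact (hm.mono_measure (Measure.restrict_mono (Icc_subset_Icc ha hb) le_rfl)).comp_measurePreserving
    h1

lemma IsEssentiallyBoundedControl.concat
    (h₁ : IsEssentiallyBoundedControl U T₁ u₁) (h₂ : IsEssentiallyBoundedControl U T₂ u₂) :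
    IsEssentiallyBoundedControl U (T₁ + T₂) (concat T₁ u₁ u₂) := by
  rw [isEssentiallyBoundedControl_iff] at h₁ h₂ ⊢
  obtain ⟨hm₁, R₁, hR₁⟩ := h₁
  obtain ⟨hm₂, R₂, hR₂⟩ := h₂
  refine ⟨?_, max R₁ R₂, ae_concat ?_ ?_⟩
  · have hsub : Icc 0 (T₁ + T₂) ⊆ Icc 0 T₁ ∪ Ioc T₁ (T₁ + T₂) := fun t ht ↦
      (le_or_gt t T₁).imp (fun h ↦ ⟨ht.1, h⟩) fun h ↦ ⟨h, ht.2⟩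
    refine AEStronglyMeasurable.mono_measure ?_ (Measure.restrict_mono hsub le_rfl)
    rw [aestronglyMeasurable_union_iff]
    constructor
    · refine hm₁.congr ?_
      filter_upwards [ae_restrict_mem measurableSet_Icc] with t ht
      rw [concat_of_le ht.2]
    · have h1 : MeasurePreserving (fun t : ℝ ↦ t - T₁)
          (volume.restrict ((fun t : ℝ ↦ t - T₁) ⁻¹' Ioc 0 T₂)) (volume.restrict (Ioc 0 T₂)) :=
        (measurePreserving_sub_right volume T₁).restrict_preimage measurableSet_Ioc
      have h2 : (fun t : ℝ ↦ t - T₁) ⁻¹' Ioc 0 T₂ = Ioc T₁ (T₁ + T₂) := by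
        ext t
        simp [add_comm]
      rw [h2] at h1
      refine ((hm₂.mono_measure (Measure.restrict_mono Ioc_subset_Icc_self
        le_rfl)).comp_measurePreserving h1).congr ?_
      filter_upwards [ae_restrict_mem measurableSet_Ioc] with t ht
      rw [concat_of_lt ht.1]
      rfl
  · filter_upwards [hR₁] with t ht h
    rw [concat_of_le h.le]
    exact ⟨ht.1, ht.2.trans (le_max_left _ _)⟩
  · filter_upwards [hR₂] with t ht h
    rw [concat_of_lt (by linarith), add_sub_cancel_right]
    exact ⟨ht.1, ht.2.trans (le_max_right _ _)⟩

lemma IsAdmissible.shift {𝒰 : ControlClass} {a b : ℝ} (h : IsAdmissible 𝒰 U T u) (ha : 0 ≤ a)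
    (hab : a ≤ b) (hb : b ≤ T) : IsAdmissible 𝒰 U (b - a) fun t ↦ u (t + a) := by
  cases 𝒰 with
  | piecewiseConstant => exact IsPiecewiseConstantControl.shift h ha hab hb
  | essentiallyBounded => exact IsEssentiallyBoundedControl.shift h ha hb

lemma IsAdmissible.concat {𝒰 : ControlClass} (h₁ : IsAdmissible 𝒰 U T₁ u₁)
    (h₂ : IsAdmissible 𝒰 U T₂ u₂) : IsAdmissible 𝒰 U (T₁ + T₂) (concat T₁ u₁ u₂) := by
  cases 𝒰 with
  | piecewiseConstant => exact IsPiecewiseConstantControl.concat h₁ h₂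
  | essentiallyBounded => exact IsEssentiallyBoundedControl.concat h₁ h₂

end Admissible

/-! ### Trajectories: restriction, concatenation, transitivity of attainability -/

section Trajectory

variable {n m : ℕ} {M : Type*} [TopologicalSpace M] [ChartedSpace (EuclideanSpace ℝ (Fin n)) M]
  {F : (x : M) → EuclideanSpace ℝ (Fin m) → TangentSpace (𝓡 n) x}
  {U : Set (EuclideanSpace ℝ (Fin m))} {𝒰 : ControlClass} {T T₁ T₂ : ℝ}
  {u u₁ u₂ : ℝ → EuclideanSpace ℝ (Fin m)} {γ γ₁ γ₂ : ℝ → M}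

lemma hasMFDerivAt_shift {t d : ℝ} {v : TangentSpace (𝓡 n) (γ (t + d))}
    (h : HasMFDerivAt 𝓘(ℝ, ℝ) (𝓡 n) γ (t + d) ((1 : ℝ →L[ℝ] ℝ).smulRight v)) :
    HasMFDerivAt 𝓘(ℝ, ℝ) (𝓡 n) (fun s ↦ γ (s + d)) t ((1 : ℝ →L[ℝ] ℝ).smulRight v) := by
  have h1 : HasMFDerivAt 𝓘(ℝ, ℝ) 𝓘(ℝ, ℝ) (fun s : ℝ ↦ s + d) t (1 : ℝ →L[ℝ] ℝ) :=
    ((hasFDerivAt_id t).add_const d).hasMFDerivAt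
  exact HasMFDerivAt.comp t h h1

lemma IsTrajectory.shift {a b : ℝ} (h : IsTrajectory F T u γ) (ha : 0 ≤ a)
    (hb : b ≤ T) : IsTrajectory F (b - a) (fun t ↦ u (t + a)) fun t ↦ γ (t + a) := by
  refine ⟨⟨?_, fun x₀ c d hc hcd hd hs ↦ ?_⟩, ?_⟩
  · exact h.1.1.comp (by fun_prop) fun t ht ↦ ⟨by linarith [ht.1], by linarith [ht.2]⟩
  · refine absolutelyContinuousOnInterval_shift (f := fun t ↦ extChartAt (𝓡 n) x₀ (γ t)) a
      (h.1.2 x₀ _ _ (by linarith) (by linarith) (by linarith) fun t ht ↦ ?_)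
    simpa using hs (t - a) ⟨by linarith [ht.1], by linarith [ht.2]⟩
  · filter_upwards [ae_Icc_shift ha hb h.2] with t ht
    exact hasMFDerivAt_shift ht

lemma IsTrajectory.concat (hT₁ : 0 ≤ T₁) (hT₂ : 0 ≤ T₂) (h₁ : IsTrajectory F T₁ u₁ γ₁)
    (h₂ : IsTrajectory F T₂ u₂ γ₂) (h : γ₁ T₁ = γ₂ 0) :
    IsTrajectory F (T₁ + T₂) (concat T₁ u₁ u₂) (concat T₁ γ₁ γ₂) := by
  refine ⟨⟨?_, fun x₀ a b ha hab hb hs ↦ ?_⟩, ae_concat ?_ ?_⟩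
  · have hsub : Icc 0 (T₁ + T₂) = Icc 0 T₁ ∪ Icc T₁ (T₁ + T₂) :=
      (Icc_union_Icc_eq_Icc hT₁ (by linarith)).symm
    rw [hsub]
    refine ContinuousOn.union_of_isClosed ?_ ?_ isClosed_Icc isClosed_Icc
    · exact h₁.1.1.congr fun t ht ↦ concat_of_le ht.2
    · refine ContinuousOn.congr (f := fun t ↦ γ₂ (t - T₁)) ?_ fun t ht ↦ concat_of_ge h ht.1
      exact h₂.1.1.comp (by fun_prop) fun t ht ↦ ⟨by linarith [ht.1], by linarith [ht.2]⟩
  · have left : ∀ c d, a ≤ c → c ≤ d → d ≤ b → d ≤ T₁ → AbsolutelyContinuousOnInterval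
        (fun t ↦ extChartAt (𝓡 n) x₀ (ControlSystem.concat T₁ γ₁ γ₂ t)) c d := by
      intro c d hac hcd hdb hd
      refine absolutelyContinuousOnInterval_congr (h₁.1.2 x₀ c d (ha.trans hac) hcd hd
        fun t ht ↦ ?_) fun t ht ↦ ?_
      · rw [← concat_of_le (f := γ₁) (g := γ₂) (ht.2.trans hd)]
        exact hs t ⟨hac.trans ht.1, ht.2.trans hdb⟩
      · rw [uIcc_of_le hcd] at ht
        simp only [concat_of_le (ht.2.trans hd)]
    have right : ∀ c d, a ≤ c → c ≤ d → d ≤ b → T₁ ≤ c → AbsolutelyContinuousOnInterval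
        (fun t ↦ extChartAt (𝓡 n) x₀ (ControlSystem.concat T₁ γ₁ γ₂ t)) c d := by
      intro c d hac hcd hdb hc
      have := absolutelyContinuousOnInterval_shift (a := c) (b := d)
        (f := fun t ↦ extChartAt (𝓡 n) x₀ (γ₂ t)) (-T₁)
        (h₂.1.2 x₀ _ _ (by linarith) (by linarith) (by linarith) fun t ht ↦ by
          have h3 := hs (t + T₁) ⟨by linarith [ht.1], by linarith [ht.2]⟩
          rwa [concat_of_ge h (by linarith [ht.1]), add_sub_cancel_right] at h3)
      refine absolutelyContinuousOnInterval_congr this fun t ht ↦ ?_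
      rw [uIcc_of_le hcd] at ht
      simp only [concat_of_ge h (hc.trans ht.1), sub_eq_add_neg]
    rcases le_total b T₁ with h3 | h3
    · exact left a b le_rfl hab le_rfl h3
    rcases le_total T₁ a with h4 | h4
    · exact right a b le_rfl hab le_rfl h4
    exact absolutelyContinuousOnInterval_trans h4 h3 (left _ _ le_rfl h4 h3 le_rfl)
      (right _ _ h4 h3 le_rfl le_rfl)
  · filter_upwards [h₁.2] with t ht hlt
    have e : ControlSystem.concat T₁ γ₁ γ₂ =ᶠ[𝓝 t] γ₁ := by
      filter_upwards [Iio_mem_nhds hlt] with s hs using concat_of_le (le_of_lt hs)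
    have := ht.congr_of_eventuallyEq e
    rw [concat_of_le hlt.le, concat_of_le hlt.le]
    exact this
  · filter_upwards [h₂.2] with t ht hlt
    have e : ControlSystem.concat T₁ γ₁ γ₂ =ᶠ[𝓝 (t + T₁)] fun s ↦ γ₂ (s + -T₁) := by
      filter_upwards [Ioi_mem_nhds (show T₁ < t + T₁ by linarith)] with s hs
      rw [concat_of_lt hs, sub_eq_add_neg]
    have e0 : t + T₁ + -T₁ = t := by ring
    have := (hasMFDerivAt_shift (t := t + T₁) (d := -T₁) (γ := γ₂)
      (v := F (γ₂ (t + T₁ + -T₁)) (u₂ t)) (by rw [e0]; exact ht)).congr_of_eventuallyEq e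
    rw [concat_of_lt (by linarith), concat_of_lt (by linarith)]
    simp only [add_sub_cancel_right] at this ⊢
    exact this

lemma attainableSet_trans {x y z : M} (hxy : y ∈ attainableSet F U 𝒰 x)
    (hyz : z ∈ attainableSet F U 𝒰 y) : z ∈ attainableSet F U 𝒰 x := by
  obtain ⟨T₁, u₁, γ₁, hT₁, hu₁, hγ₁, h0₁, h1₁⟩ := hxy
  obtain ⟨T₂, u₂, γ₂, hT₂, hu₂, hγ₂, h0₂, h1₂⟩ := hyz
  have h : γ₁ T₁ = γ₂ 0 := h1₁.trans h0₂.symm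
  refine ⟨T₁ + T₂, concat T₁ u₁ u₂, concat T₁ γ₁ γ₂, add_nonneg hT₁ hT₂,
    hu₁.concat hu₂, hγ₁.concat hT₁ hT₂ hγ₂ h, ?_, ?_⟩
  · rw [concat_of_le hT₁, h0₁]
  · rw [concat_of_ge h (by linarith), add_sub_cancel_left, h1₂]

end Trajectory

/-! ### The system in coordinates, and its localization to bounded `C¹` families -/

section Charts

variable {n m : ℕ} {M : Type*} [TopologicalSpace M] [ChartedSpace (EuclideanSpace ℝ (Fin n)) M]
  {F : (x : M) → EuclideanSpace ℝ (Fin m) → TangentSpace (𝓡 n) x}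
  {U : Set (EuclideanSpace ℝ (Fin m))}

/-- Locally in the state, the vector fields with controls in `K` are bounded, together with their
derivatives, uniformly in the control. -/
def IsLocallyBounded (F : (x : M) → EuclideanSpace ℝ (Fin m) → TangentSpace (𝓡 n) x)
    (K : Set (EuclideanSpace ℝ (Fin m))) : Prop :=
  ∀ x₀ : M, ∃ N ∈ 𝓝 (extChartAt (𝓡 n) x₀ x₀), ∃ C : ℝ≥0, ∀ v ∈ K, ∀ z ∈ N,
    ‖inChart F x₀ v z‖ ≤ C ∧ ‖fderiv ℝ (inChart F x₀ v) z‖ ≤ C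

lemma IsLocallyLipschitzOnBoundedControls.isLocallyBounded
    (h : IsLocallyLipschitzOnBoundedControls F U) (R : ℝ) :
    IsLocallyBounded F {v ∈ U | ‖v‖ ≤ R} := by
  intro x₀
  obtain ⟨N, hN, C, hC⟩ := h x₀ R
  -- A Lipschitz constant bounds the derivative only where the set is a neighbourhood, so `N` is
  -- replaced by its interior.
  refine ⟨interior N, interior_mem_nhds.2 hN, C, fun v hv z hz ↦ ?_⟩
  obtain ⟨h1, h2⟩ := hC v hv.1 hv.2
  exact ⟨h1 z (interior_subset hz),
    norm_fderiv_le_of_lipschitzOn ℝ (mem_interior_iff_mem_nhds.1 hz) h2⟩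

variable [IsManifold (𝓡 n) ∞ M]

lemma contDiffAt_transition {x₀ x₁ : M} {z : EuclideanSpace ℝ (Fin n)}
    (hz : z ∈ (extChartAt (𝓡 n) x₀).target)
    (hz' : (extChartAt (𝓡 n) x₀).symm z ∈ (extChartAt (𝓡 n) x₁).source) :
    ContDiffAt ℝ ∞ (fun w ↦ extChartAt (𝓡 n) x₁ ((extChartAt (𝓡 n) x₀).symm w)) z := by
  rw [← contMDiffAt_iff_contDiffAt]
  have h1 : ContMDiffAt 𝓘(ℝ, EuclideanSpace ℝ (Fin n)) (𝓡 n) ∞ (extChartAt (𝓡 n) x₀).symm z :=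
    (contMDiffOn_extChartAt_symm x₀).contMDiffAt ((isOpen_extChartAt_target x₀).mem_nhds hz)
  have h2 : ContMDiffAt (𝓡 n) 𝓘(ℝ, EuclideanSpace ℝ (Fin n)) ∞ (extChartAt (𝓡 n) x₁)
      ((extChartAt (𝓡 n) x₀).symm z) := contMDiffAt_extChartAt' (by simpa using hz')
  exact h2.comp z h1

/-- Smoothness into the tangent bundle is tested in a trivialization; this identification turns it
into smoothness of `inChart`. -/
lemma inChart_eq_trivializationAt {x₀ : M} {z : EuclideanSpace ℝ (Fin n)}
    (hz : z ∈ (extChartAt (𝓡 n) x₀).target) (v : EuclideanSpace ℝ (Fin m)) :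
    inChart F x₀ v z = (trivializationAt (EuclideanSpace ℝ (Fin n)) (TangentSpace (𝓡 n)) x₀
      ⟨(extChartAt (𝓡 n) x₀).symm z, F ((extChartAt (𝓡 n) x₀).symm z) v⟩).2 := by
  have hs : (extChartAt (𝓡 n) x₀).symm z ∈ (chartAt (EuclideanSpace ℝ (Fin n)) x₀).source := by
    simpa using (extChartAt (𝓡 n) x₀).map_target hz
  rw [inChart, ← TangentBundle.continuousLinearMapAt_trivializationAt hs]
  exact Bundle.Trivialization.continuousLinearMapAt_apply_of_mem (R := ℝ)
    (trivializationAt (EuclideanSpace ℝ (Fin n)) (TangentSpace (𝓡 n)) x₀) (by simpa using hs) _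

/-- A smooth system is smooth in charts, jointly in the state and in the control. -/
lemma contDiffOn_inChart (hF : IsSmoothSystem F U) (x₀ : M) :
    ContDiffOn ℝ ∞ (fun q : EuclideanSpace ℝ (Fin n) × EuclideanSpace ℝ (Fin m) ↦
      inChart F x₀ q.2 q.1) ((extChartAt (𝓡 n) x₀).target ×ˢ U) := by
  set e := trivializationAt (EuclideanSpace ℝ (Fin n)) (TangentSpace (𝓡 n) (M := M)) x₀
  have h1 : ContMDiffOn ((𝓡 n).prod (𝓡 m)) 𝓘(ℝ, EuclideanSpace ℝ (Fin n)) ∞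
      (fun p : M × EuclideanSpace ℝ (Fin m) ↦
        (e (⟨p.1, F p.1 p.2⟩ : TangentBundle (𝓡 n) M)).2)
      ((chartAt (EuclideanSpace ℝ (Fin n)) x₀).source ×ˢ U) := by
    have h2 : ContMDiffOn ((𝓡 n).prod (𝓡 m)) (𝓡 n).tangent ∞
      (fun p : M × EuclideanSpace ℝ (Fin m) ↦ (⟨p.1, F p.1 p.2⟩ : TangentBundle (𝓡 n) M))
      ((chartAt (EuclideanSpace ℝ (Fin n)) x₀).source ×ˢ U) :=
      ContMDiffOn.mono hF (prod_mono (subset_univ _) le_rfl)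
    refine ((e.contMDiffOn_iff (IB := 𝓡 n) (fun p hp ↦ ?_)).1 h2).2
    rw [e.mem_source]
    simpa [e] using hp.1
  have h3 : ContMDiffOn (𝓘(ℝ, EuclideanSpace ℝ (Fin n)).prod (𝓡 m)) ((𝓡 n).prod (𝓡 m)) ∞
      (fun q : EuclideanSpace ℝ (Fin n) × EuclideanSpace ℝ (Fin m) ↦
        ((extChartAt (𝓡 n) x₀).symm q.1, q.2)) ((extChartAt (𝓡 n) x₀).target ×ˢ U) :=
    ((contMDiffOn_extChartAt_symm x₀).comp contMDiffOn_fst fun q hq ↦ hq.1).prodMk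
      contMDiffOn_snd
  have h4 := h1.comp h3 fun q hq ↦ ⟨by simpa using (extChartAt (𝓡 n) x₀).map_target hq.1, hq.2⟩
  rw [← modelWithCornersSelf_prod, chartedSpaceSelf_prod, contMDiffOn_iff_contDiffOn] at h4
  exact h4.congr fun q hq ↦ inChart_eq_trivializationAt hq.1 q.2

/-- Derivative in the state variable of a function that is `C¹` on a product with an open set. -/
lemma differentiable_fst_of_contDiffOn {E V G : Type*} [NormedAddCommGroup E] [NormedSpace ℝ E]
    [NormedAddCommGroup V] [NormedSpace ℝ V] [NormedAddCommGroup G] [NormedSpace ℝ G]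
    {f : E × V → G} {O : Set E} {U : Set V} (hO : IsOpen O) (hf : ContDiffOn ℝ 1 f (O ×ˢ U)) :
    (∀ q ∈ O ×ˢ U, DifferentiableAt ℝ (fun z ↦ f (z, q.2)) q.1) ∧
      ContinuousOn (fun q : E × V ↦ fderiv ℝ (fun z ↦ f (z, q.2)) q.1) (O ×ˢ U) := by
  -- Since `U` is arbitrary, the joint derivative `f'` need not be unique. Its restriction to the
  -- state directions is nevertheless the true partial derivative, as `O` is open, and it inherits
  -- the continuity of `f'`.
  have key : ∀ q₀ ∈ O ×ˢ U, ∃ f' : E × V → E × V →L[ℝ] G, ContinuousWithinAt f' (O ×ˢ U) q₀ ∧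
      ∀ᶠ q in 𝓝[O ×ˢ U] q₀, HasFDerivAt (fun z ↦ f (z, q.2))
        ((f' q).comp (ContinuousLinearMap.inl ℝ E V)) q.1 := by
    intro q₀ hq₀
    have h := hf q₀ hq₀
    rw [show (1 : ℕ∞ω) = 0 + 1 by simp,
      contDiffWithinAt_succ_iff_hasFDerivWithinAt' (by simp)] at h
    obtain ⟨u, hu, -, -, f', hf', hc⟩ := h
    rw [insert_eq_of_mem hq₀] at hu
    refine ⟨f', hc.continuousWithinAt, ?_⟩
    filter_upwards [hu, self_mem_nhdsWithin] with q hq hqs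
    have h1 := hf' q hq
    have h2 : HasFDerivWithinAt (fun z : E ↦ (z, q.2)) (ContinuousLinearMap.inl ℝ E V) O q.1 :=
      (hasFDerivAt_prodMk_left q.1 q.2).hasFDerivWithinAt
    have h3 : HasFDerivWithinAt (fun z ↦ f (z, q.2))
        ((f' q).comp (ContinuousLinearMap.inl ℝ E V)) O q.1 :=
      HasFDerivWithinAt.comp (t := O ×ˢ U) (g := f) q.1 h1 h2 fun z hz ↦ ⟨hz, hqs.2⟩
    exact h3.hasFDerivAt (hO.mem_nhds hqs.1)
  constructor
  · intro q hq
    obtain ⟨f', -, h⟩ := key q hq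
    exact (h.self_of_nhdsWithin hq).differentiableAt
  · intro q hq
    obtain ⟨f', hc, h⟩ := key q hq
    have h1 : ContinuousWithinAt (fun q ↦ (f' q).comp (ContinuousLinearMap.inl ℝ E V))
        (O ×ˢ U) q := by
      fun_prop
    exact h1.congr_of_eventuallyEq (h.mono fun q hq ↦ hq.fderiv)
      (h.self_of_nhdsWithin hq).fderiv

lemma isLocallyBounded_of_isCompact (hF : IsSmoothSystem F U)
    {K : Set (EuclideanSpace ℝ (Fin m))} (hK : IsCompact K) (hKU : K ⊆ U) :
    IsLocallyBounded F K := by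
  intro x₀
  have hc := contDiffOn_inChart hF x₀
  have hd := (differentiable_fst_of_contDiffOn (isOpen_extChartAt_target x₀)
    (hc.of_le (by simp))).2
  have hz : extChartAt (𝓡 n) x₀ x₀ ∈ (extChartAt (𝓡 n) x₀).target := mem_extChartAt_target x₀
  refine hK.induction_on (p := fun S ↦ ∃ N ∈ 𝓝 (extChartAt (𝓡 n) x₀ x₀), ∃ C : ℝ≥0, ∀ v ∈ S,
    ∀ z ∈ N, ‖inChart F x₀ v z‖ ≤ C ∧ ‖fderiv ℝ (inChart F x₀ v) z‖ ≤ C) ?_ ?_ ?_ ?_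
  · exact ⟨univ, Filter.univ_mem, 0, by simp⟩
  · rintro s t hst ⟨N, hN, C, h⟩
    exact ⟨N, hN, C, fun v hv ↦ h v (hst hv)⟩
  · rintro s t ⟨N, hN, C, h⟩ ⟨N', hN', C', h'⟩
    refine ⟨N ∩ N', Filter.inter_mem hN hN', max C C', fun v hv z hz ↦ ?_⟩
    rcases hv with hv | hv
    · have := h v hv z hz.1
      exact ⟨this.1.trans (by simp), this.2.trans (by simp)⟩
    · have := h' v hv z hz.2
      exact ⟨this.1.trans (by simp), this.2.trans (by simp)⟩
  · intro v hv
    have c1 := (hc.continuousOn _ (mk_mem_prod hz (hKU hv))).norm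
    have c2 := (hd _ (mk_mem_prod hz (hKU hv))).norm
    set a := ‖inChart F x₀ v (extChartAt (𝓡 n) x₀ x₀)‖
    set b := ‖fderiv ℝ (inChart F x₀ v) (extChartAt (𝓡 n) x₀ x₀)‖
    have h1 := (c1.eventually (gt_mem_nhds (lt_add_one _))).and
      (c2.eventually (gt_mem_nhds (lt_add_one _)))
    rw [nhdsWithin_prod_eq, (isOpen_extChartAt_target x₀).nhdsWithin_eq hz] at h1
    obtain ⟨p, hp, q, hq, hpq⟩ := Filter.eventually_prod_iff.1 h1
    refine ⟨{v | q v}, nhdsWithin_mono _ hKU hq, {z | p z}, hp,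
      max ⟨a + 1, by positivity⟩ ⟨b + 1, by positivity⟩, fun w hw z hz ↦ ?_⟩
    have := hpq hz hw
    exact ⟨this.1.le.trans (le_max_left (a + 1) (b + 1)),
      this.2.le.trans (le_max_right (a + 1) (b + 1))⟩

/-- The family `H` is globally bounded and `C¹`, and represents the system with controls in `K` in
the ball of radius `ρ` at the centre of the chart at `x₀`. -/
structure IsChartModel (F : (x : M) → EuclideanSpace ℝ (Fin m) → TangentSpace (𝓡 n) x)
    (K : Set (EuclideanSpace ℝ (Fin m))) (x₀ : M)
    (H : K → EuclideanSpace ℝ (Fin n) → EuclideanSpace ℝ (Fin n))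
    (H' : K → EuclideanSpace ℝ (Fin n) → EuclideanSpace ℝ (Fin n) →L[ℝ] EuclideanSpace ℝ (Fin n))
    (C : ℝ≥0) (ρ : ℝ) : Prop where
  pos : 0 < ρ
  family : IsBoundedC1Family H H' C
  ball_subset : Metric.ball (extChartAt (𝓡 n) x₀ x₀) ρ ⊆ (extChartAt (𝓡 n) x₀).target
  eq_inChart : ∀ (v : K), ∀ z ∈ Metric.ball (extChartAt (𝓡 n) x₀ x₀) ρ,
    H v z = inChart F x₀ v z

/-- Near the centre of a chart, the system agrees with a globally bounded `C¹` family. -/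
lemma exists_isChartModel (hF : IsSmoothSystem F U) {K : Set (EuclideanSpace ℝ (Fin m))}
    (hKU : K ⊆ U) (hK : IsLocallyBounded F K) (x₀ : M) :
    ∃ H H' C ρ, IsChartModel F K x₀ H H' C ρ := by
  obtain ⟨N, hN, C, hC⟩ := hK x₀
  obtain ⟨r, hr, hball⟩ := Metric.mem_nhds_iff.1 (Filter.inter_mem hN
    ((isOpen_extChartAt_target x₀).mem_nhds (mem_extChartAt_target x₀)))
  set z₀ := extChartAt (𝓡 n) x₀ x₀
  have hc := contDiffOn_inChart hF x₀
  obtain ⟨hd, hdc⟩ := differentiable_fst_of_contDiffOn (isOpen_extChartAt_target x₀)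
    (hc.of_le (show (1 : ℕ∞ω) ≤ (∞ : ℕ∞ω) by simp))
  -- Multiplying by `χ` leaves the fields unchanged on the ball of radius `r / 3` and kills them
  -- beyond `r / 2`. The product rule gives the derivative bound `C + B * C`.
  let χ : ContDiffBump z₀ := ⟨r / 3, r / 2, by positivity, by linarith⟩
  have hχ : ContDiff ℝ 1 χ := χ.contDiff
  obtain ⟨B, hB⟩ := (χ.hasCompactSupport.fderiv ℝ).exists_bound_of_continuous
    (hχ.continuous_fderiv (by simp))
  have hB0 : 0 ≤ B := (norm_nonneg _).trans (hB z₀)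
  let H : K → EuclideanSpace ℝ (Fin n) → EuclideanSpace ℝ (Fin n) :=
    fun v z ↦ χ z • inChart F x₀ v z
  let D : K → EuclideanSpace ℝ (Fin n) → EuclideanSpace ℝ (Fin n) →L[ℝ]
      EuclideanSpace ℝ (Fin n) := fun v z ↦
    χ z • fderiv ℝ (inChart F x₀ v) z + (fderiv ℝ χ z).smulRight (inChart F x₀ v z)
  have hin : ∀ (v : K), ∀ z ∈ Metric.ball z₀ r, HasFDerivAt (H v) (D v z) z := fun v z hz ↦
    (hχ.differentiable (by simp) z).hasFDerivAt.smul
      (hd (z, v) ⟨(hball hz).2, hKU v.2⟩).hasFDerivAt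
  have hχ0 : ∀ z ∉ Metric.closedBall z₀ (r / 2), ∀ᶠ w in 𝓝 z, χ w = 0 := fun z hz ↦ by
    filter_upwards [Metric.isClosed_closedBall.isOpen_compl.mem_nhds hz] with w hw
    refine χ.zero_of_le_dist ?_
    rw [mem_compl_iff, Metric.mem_closedBall, not_le] at hw
    exact hw.le
  have hout : ∀ (v : K), ∀ z ∉ Metric.closedBall z₀ (r / 2), H v =ᶠ[𝓝 z] 0 := fun v z hz ↦ by
    filter_upwards [hχ0 z hz] with w hw
    simp [H, hw]
  -- Two open regions cover the space: on one the product formula is valid, on the other `H v`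
  -- vanishes locally.
  have hcov : ∀ z, z ∈ Metric.ball z₀ r ∨ z ∉ Metric.closedBall z₀ (r / 2) := fun z ↦ by
    rw [Metric.mem_ball, Metric.mem_closedBall, not_le]
    rcases lt_or_ge (dist z z₀) r with h | h
    · exact Or.inl h
    · exact Or.inr (by linarith)
  have hpair : ∀ (v : K) z, z ∈ Metric.ball z₀ r → ∀ {Y : Type} [TopologicalSpace Y]
      {f : EuclideanSpace ℝ (Fin n) × EuclideanSpace ℝ (Fin m) → Y},
      ContinuousOn f ((extChartAt (𝓡 n) x₀).target ×ˢ U) →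
      ContinuousAt (fun q : K × EuclideanSpace ℝ (Fin n) ↦ f (q.2, q.1)) (v, z) := by
    intro v z hz Y _ f hf
    have h1 : Filter.Tendsto (fun q : K × EuclideanSpace ℝ (Fin n) ↦
        (q.2, (q.1 : EuclideanSpace ℝ (Fin m)))) (𝓝 (v, z))
        (𝓝[(extChartAt (𝓡 n) x₀).target ×ˢ U] (z, (v : EuclideanSpace ℝ (Fin m)))) := by
      refine tendsto_nhdsWithin_iff.2 ⟨Continuous.tendsto (by fun_prop) _, ?_⟩
      filter_upwards [continuous_snd.continuousAt.preimage_mem_nhds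
        (Metric.isOpen_ball.mem_nhds hz)] with q hq
      exact ⟨(hball hq).2, hKU q.1.2⟩
    exact (hf (z, v) ⟨(hball hz).2, hKU v.2⟩).tendsto.comp h1
  refine ⟨H, fun v ↦ fderiv ℝ (H v), C + B.toNNReal * C, r / 3, by positivity, ⟨?_, ?_, ?_, ?_, ?_⟩,
    fun z hz ↦ (hball (Metric.ball_subset_ball (by linarith) hz)).2, fun v z hz ↦ ?_⟩
  · rw [continuous_iff_continuousAt]
    rintro ⟨v, z⟩
    rcases hcov z with hz | hz
    · have := hpair v z hz hc.continuousOn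
      have h2 : ContinuousAt (fun q : K × EuclideanSpace ℝ (Fin n) ↦ χ q.2) (v, z) :=
        (hχ.continuous.comp continuous_snd).continuousAt
      exact h2.smul this
    · have : (fun q : K × EuclideanSpace ℝ (Fin n) ↦ H q.1 q.2) =ᶠ[𝓝 (v, z)] fun _ ↦ 0 := by
        filter_upwards [continuous_snd.continuousAt.eventually (hχ0 z hz)] with q hq
        simp [H, hq]
      exact continuousAt_const.congr this.symm
  · rw [continuous_iff_continuousAt]
    rintro ⟨v, z⟩
    rcases hcov z with hz | hz
    · have h1 := hpair v z hz hc.continuousOn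
      have h2 : ContinuousAt (fun q : K × EuclideanSpace ℝ (Fin n) ↦ χ q.2) (v, z) :=
        (hχ.continuous.comp continuous_snd).continuousAt
      have h3 := hpair v z hz hdc
      have h4 : ContinuousAt (fun q : K × EuclideanSpace ℝ (Fin n) ↦ fderiv ℝ χ q.2) (v, z) :=
        ((hχ.continuous_fderiv (by simp)).comp continuous_snd).continuousAt
      have h5 : ContinuousAt (fun q : K × EuclideanSpace ℝ (Fin n) ↦ D q.1 q.2) (v, z) :=
        (h2.smul h3).add
          (isBoundedBilinearMap_smulRight.continuous.continuousAt.comp (h4.prodMk h1))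
      refine h5.congr ?_
      filter_upwards [continuous_snd.continuousAt.preimage_mem_nhds
        (Metric.isOpen_ball.mem_nhds hz)] with q hq
      exact (hin q.1 q.2 hq).fderiv.symm
    · have : (fun q : K × EuclideanSpace ℝ (Fin n) ↦ fderiv ℝ (H q.1) q.2) =ᶠ[𝓝 (v, z)]
          fun _ ↦ 0 := by
        filter_upwards [continuous_snd.continuousAt.preimage_mem_nhds
          (Metric.isClosed_closedBall.isOpen_compl.mem_nhds hz)] with q hq
        rw [(hout q.1 q.2 hq).fderiv_eq]
        simp
      exact continuousAt_const.congr this.symm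
  · intro v z
    rcases hcov z with hz | hz
    · exact (hin v z hz).differentiableAt.hasFDerivAt
    · exact ((hasFDerivAt_const 0 z).congr_of_eventuallyEq (hout v z hz)).differentiableAt.hasFDerivAt
  · intro v z
    rcases hcov z with hz | hz
    · have h1 := (hC v v.2 z (hball hz).1).1
      have h2 : ‖χ z‖ ≤ 1 := by rw [Real.norm_of_nonneg χ.nonneg]; exact χ.le_one
      have : ‖H v z‖ ≤ C := by
        simp only [H, norm_smul]
        nlinarith [norm_nonneg (inChart F x₀ v z), norm_nonneg (χ z)]
      refine this.trans ?_
      exact_mod_cast le_self_add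
    · rw [(hout v z hz).self_of_nhds]
      simp only [Pi.zero_apply, norm_zero]
      positivity
  · intro v z
    rcases hcov z with hz | hz
    · obtain ⟨h1, h1'⟩ := hC v v.2 z (hball hz).1
      have h2 : ‖χ z‖ ≤ 1 := by rw [Real.norm_of_nonneg χ.nonneg]; exact χ.le_one
      rw [(hin v z hz).fderiv]
      push_cast
      rw [Real.coe_toNNReal _ hB0]
      refine (norm_add_le _ _).trans (add_le_add ?_ ?_)
      · rw [norm_smul]
        nlinarith [norm_nonneg (fderiv ℝ (inChart F x₀ v) z), norm_nonneg (χ z)]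
      · rw [ContinuousLinearMap.norm_smulRight_apply]
        exact mul_le_mul (hB z) h1 (norm_nonneg _) hB0
    · rw [(hout v z hz).fderiv_eq, fderiv_zero]
      simp only [Pi.zero_apply, norm_zero]
      positivity
  · simp [H, χ.one_of_mem_closedBall (Metric.ball_subset_closedBall hz)]

lemma comp_smulRight_one {E G : Type*} [NormedAddCommGroup E] [NormedSpace ℝ E]
    [NormedAddCommGroup G] [NormedSpace ℝ G] (A : E →L[ℝ] G) (w : E) :
    A.comp ((1 : ℝ →L[ℝ] ℝ).smulRight w) = (1 : ℝ →L[ℝ] ℝ).smulRight (A w) := by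
  ext
  simp

lemma comp_toSpanSingleton_eq {E G : Type*} [NormedAddCommGroup E] [NormedSpace ℝ E]
    [NormedAddCommGroup G] [NormedSpace ℝ G] {A : E →L[ℝ] G} {w : E} {w' : G} (h : A w = w') :
    A.comp (ContinuousLinearMap.toSpanSingleton ℝ w) = (1 : ℝ →L[ℝ] ℝ).smulRight w' := by
  ext
  simp [h]

lemma hasDerivAt_extChartAt_comp {γ : ℝ → M} {x₀ : M} {t : ℝ} {v : EuclideanSpace ℝ (Fin m)}
    (hs : γ t ∈ (extChartAt (𝓡 n) x₀).source)
    (h : HasMFDerivAt 𝓘(ℝ, ℝ) (𝓡 n) γ t ((1 : ℝ →L[ℝ] ℝ).smulRight (F (γ t) v))) :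
    HasDerivAt (fun s ↦ extChartAt (𝓡 n) x₀ (γ s))
      (inChart F x₀ v (extChartAt (𝓡 n) x₀ (γ t))) t := by
  have h1 : HasMFDerivAt (𝓡 n) 𝓘(ℝ, EuclideanSpace ℝ (Fin n)) (extChartAt (𝓡 n) x₀) (γ t)
      (mfderiv (𝓡 n) (𝓡 n) (extChartAt (𝓡 n) x₀) (γ t)) :=
    (mdifferentiableAt_extChartAt (by simpa using hs)).hasMFDerivAt
  have h3 : inChart F x₀ v (extChartAt (𝓡 n) x₀ (γ t)) =
      mfderiv (𝓡 n) (𝓡 n) (extChartAt (𝓡 n) x₀) (γ t) (F (γ t) v) := by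
    rw [inChart, (extChartAt (𝓡 n) x₀).left_inv hs]
  have h2 : HasFDerivAt (fun s ↦ extChartAt (𝓡 n) x₀ (γ s))
      ((1 : ℝ →L[ℝ] ℝ).smulRight (inChart F x₀ v (extChartAt (𝓡 n) x₀ (γ t)))) t := by
    refine hasMFDerivAt_iff_hasFDerivAt.1 ((HasMFDerivAt.comp t h1 h).congr_mfderiv ?_)
    rw [h3]
    exact comp_smulRight_one (E := EuclideanSpace ℝ (Fin n)) (G := EuclideanSpace ℝ (Fin n))
      (mfderiv (𝓡 n) (𝓡 n) (extChartAt (𝓡 n) x₀) (γ t)) (F (γ t) v)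
  simpa using h2.hasDerivAt

lemma hasMFDerivAt_extChartAt_symm_comp {ξ : ℝ → EuclideanSpace ℝ (Fin n)} {x₀ : M} {t : ℝ}
    {v : EuclideanSpace ℝ (Fin m)} (hs : ξ t ∈ (extChartAt (𝓡 n) x₀).target)
    (h : HasDerivAt ξ (inChart F x₀ v (ξ t)) t) :
    HasMFDerivAt 𝓘(ℝ, ℝ) (𝓡 n) (fun s ↦ (extChartAt (𝓡 n) x₀).symm (ξ s)) t
      ((1 : ℝ →L[ℝ] ℝ).smulRight (F ((extChartAt (𝓡 n) x₀).symm (ξ t)) v)) := by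
  have h1 : HasMFDerivAt 𝓘(ℝ, EuclideanSpace ℝ (Fin n)) (𝓡 n) (extChartAt (𝓡 n) x₀).symm (ξ t)
      (mfderivWithin 𝓘(ℝ, EuclideanSpace ℝ (Fin n)) (𝓡 n) (extChartAt (𝓡 n) x₀).symm
        (range (𝓡 n)) (ξ t)) := by
    have := (mdifferentiableWithinAt_extChartAt_symm hs).hasMFDerivWithinAt
    rw [ModelWithCorners.range_eq_univ, hasMFDerivWithinAt_univ] at this
    rwa [ModelWithCorners.range_eq_univ]
  have h2 := HasMFDerivAt.comp t h1 (hasMFDerivAt_iff_hasFDerivAt.2 h.hasFDerivAt)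
  have h3 := DFunLike.congr_fun (mfderivWithin_extChartAt_symm_comp_mfderiv_extChartAt hs)
    (F ((extChartAt (𝓡 n) x₀).symm (ξ t)) v)
  refine h2.congr_mfderiv ?_
  exact comp_toSpanSingleton_eq (E := EuclideanSpace ℝ (Fin n)) (G := EuclideanSpace ℝ (Fin n))
    (A := mfderivWithin 𝓘(ℝ, EuclideanSpace ℝ (Fin n)) (𝓡 n) (extChartAt (𝓡 n) x₀).symm
      (range (𝓡 n)) (ξ t)) (w := inChart F x₀ v (ξ t)) (w' := F ((extChartAt (𝓡 n) x₀).symm (ξ t)) v)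
    h3

end Charts

/-! ### Reducing a control to a measurable one with values in a good subset of `U` -/

section Controls

variable {n m : ℕ} {M : Type*} [TopologicalSpace M] [ChartedSpace (EuclideanSpace ℝ (Fin n)) M]
  [IsManifold (𝓡 n) ∞ M]
  {F : (x : M) → EuclideanSpace ℝ (Fin m) → TangentSpace (𝓡 n) x}
  {U : Set (EuclideanSpace ℝ (Fin m))} {T : ℝ} {u : ℝ → EuclideanSpace ℝ (Fin m)}

/-- Families are indexed by the subtype `K`, so the control must take values in `K` at every time; a
modification on a null set achieves this. -/
lemma exists_stronglyMeasurable_of_ae_mem {K : Set (EuclideanSpace ℝ (Fin m))}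
    {μ : Measure ℝ} (hu : AEMeasurable u μ) (hK : ∀ᵐ t ∂μ, u t ∈ K) (hne : K.Nonempty) :
    ∃ w : ℝ → K, StronglyMeasurable w ∧ ∀ᵐ t ∂μ, u t = w t := by
  obtain ⟨g, hg, hgK, h⟩ := hu.exists_ae_eq_range_subset hK hne
  exact ⟨fun t ↦ ⟨g t, hgK (mem_range_self t)⟩, hg.subtype_mk.stronglyMeasurable, h⟩

/-- A piecewise constant control is measurable and takes finitely many values. -/
lemma IsPiecewiseConstantControl.exists_finite (hT : 0 < T)
    (h : IsPiecewiseConstantControl U T u) :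
    ∃ K ⊆ U, K.Finite ∧ K.Nonempty ∧ AEMeasurable u (volume.restrict (Icc 0 T)) ∧
      ∀ᵐ t ∂volume.restrict (Icc 0 T), u t ∈ K := by
  obtain ⟨-, N, τ, hτ, h0, hN, hu⟩ := h
  have hN0 : 0 < N := by
    rcases Nat.eq_zero_or_pos N with rfl | h
    · rw [h0] at hN; exact absurd hN hT.ne
    · exact h
  choose v hv hv' using hu
  have hcov : ∀ N' : ℕ, 0 < N' → ∀ t ∈ Icc (τ 0) (τ N'), ∃ i < N', t ∈ Icc (τ i) (τ (i + 1)) := by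
    intro N' hN'
    induction N', hN' using Nat.le_induction with
    | base => exact fun t ht ↦ ⟨0, one_pos, ht⟩
    | succ k hk ih =>
      intro t ht
      rcases le_total t (τ k) with h | h
      · obtain ⟨i, hi, hi'⟩ := ih t ⟨ht.1, h⟩
        exact ⟨i, by omega, hi'⟩
      · exact ⟨k, by omega, h, ht.2⟩
  have hsub : Icc 0 T ⊆ ⋃ i : Fin N, Icc (τ i) (τ (i + 1)) := fun t ht ↦ by
    rw [← h0, ← hN] at ht
    obtain ⟨i, hi, hi'⟩ := hcov N hN0 t ht
    exact mem_iUnion.2 ⟨⟨i, hi⟩, hi'⟩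
  have hae : ∀ i : Fin N, ∀ᵐ t ∂volume.restrict (Icc (τ i) (τ (i + 1))), u t = v i i.2 := by
    intro i
    rw [← Measure.restrict_congr_set Ioo_ae_eq_Icc]
    filter_upwards [ae_restrict_mem measurableSet_Ioo] with t ht using hv' i i.2 t ht
  refine ⟨range fun i : Fin N ↦ v i i.2, ?_, finite_range _, ⟨_, mem_range_self ⟨0, hN0⟩⟩, ?_, ?_⟩
  · rintro _ ⟨i, rfl⟩
    exact hv i i.2
  · refine AEMeasurable.mono_measure ?_ (Measure.restrict_mono hsub le_rfl)
    rw [aemeasurable_iUnion_iff]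
    exact fun i ↦ aemeasurable_const.congr ((hae i).mono fun t ht ↦ ht.symm)
  · refine ae_mono (Measure.restrict_mono hsub le_rfl) ?_
    refine (ae_restrict_iUnion_iff _ _).2 ?_
    exact fun i ↦ (hae i).mono fun t ht ↦ ht ▸ mem_range_self i

/-- An admissible control coincides almost everywhere with a measurable one whose values lie in a
set of controls where the system is uniformly Lipschitz. -/
lemma IsAdmissible.exists_stronglyMeasurable {𝒰 : ControlClass} (hF : IsSmoothSystem F U)
    (hU : 𝒰 = ControlClass.essentiallyBounded →
      IsClosed U ∨ IsLocallyLipschitzOnBoundedControls F U)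
    (hT : 0 < T) (h : IsAdmissible 𝒰 U T u) :
    ∃ K ⊆ U, IsLocallyBounded F K ∧ ∃ w : ℝ → K, StronglyMeasurable w ∧
      ∀ᵐ t ∂volume.restrict (Icc 0 T), u t = w t := by
  cases 𝒰 with
  | piecewiseConstant =>
    obtain ⟨K, hKU, hfin, hne, hm, hK⟩ := IsPiecewiseConstantControl.exists_finite hT h
    exact ⟨K, hKU, isLocallyBounded_of_isCompact hF hfin.isCompact hKU,
      exists_stronglyMeasurable_of_ae_mem hm hK hne⟩
  | essentiallyBounded =>
    obtain ⟨hm, R, hR⟩ := isEssentiallyBoundedControl_iff.1 h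
    -- As `T > 0`, the interval has positive measure, so the almost-everywhere condition holds at
    -- some time and provides a point.
    have hne : {v ∈ U | ‖v‖ ≤ R}.Nonempty := by
      have : (ae (volume.restrict (Icc 0 T))).NeBot := by
        rw [ae_neBot, Ne, Measure.restrict_eq_zero]
        simp [hT]
      obtain ⟨t, ht⟩ := hR.exists
      exact ⟨u t, ht⟩
    refine ⟨{v ∈ U | ‖v‖ ≤ R}, sep_subset _ _, ?_,
      exists_stronglyMeasurable_of_ae_mem hm.aemeasurable hR hne⟩
    rcases hU rfl with hc | hl
    · have : {v ∈ U | ‖v‖ ≤ R} = U ∩ Metric.closedBall 0 R := by ext; simp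
      rw [this]
      exact isLocallyBounded_of_isCompact hF ((isCompact_closedBall _ _).inter_left hc)
        inter_subset_left
    · exact hl.isLocallyBounded R

end Controls

/-! ### Trajectories in a chart as solutions of integral equations -/

section ChartModel

variable {n m : ℕ} {M : Type*} [TopologicalSpace M] [ChartedSpace (EuclideanSpace ℝ (Fin n)) M]
  {F : (x : M) → EuclideanSpace ℝ (Fin m) → TangentSpace (𝓡 n) x}
  {U : Set (EuclideanSpace ℝ (Fin m))} {h : ℝ} {u : ℝ → EuclideanSpace ℝ (Fin m)} {γ : ℝ → M}
  {K : Set (EuclideanSpace ℝ (Fin m))} {x₀ : M}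
  {H : K → EuclideanSpace ℝ (Fin n) → EuclideanSpace ℝ (Fin n)}
  {H' : K → EuclideanSpace ℝ (Fin n) → EuclideanSpace ℝ (Fin n) →L[ℝ] EuclideanSpace ℝ (Fin n)}
  {C : ℝ≥0} {ρ : ℝ} {w : ℝ → K} {𝒰 : ControlClass}

lemma IsTrajectory.continuousOn_extChartAt_comp (hγ : IsTrajectory F h u γ)
    (hs : ∀ t ∈ Icc 0 h, γ t ∈ (extChartAt (𝓡 n) x₀).source) :
    ContinuousOn (fun t ↦ extChartAt (𝓡 n) x₀ (γ t)) (Icc 0 h) :=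
  (continuousOn_extChartAt x₀).comp hγ.1.1 hs

lemma ae_mem_Icc_of_restrict {p : ℝ → Prop} (hp : ∀ᵐ t ∂volume.restrict (Icc 0 h), p t) :
    ∀ᵐ t : ℝ, t ∈ Ioo 0 h → p t := by
  rw [ae_restrict_iff' measurableSet_Icc] at hp
  exact hp.mono fun t ht h' ↦ ht (Ioo_subset_Icc_self h')

variable [IsManifold (𝓡 n) ∞ M]

namespace IsChartModel

lemma ae_hasDerivAt (hH : IsChartModel F K x₀ H H' C ρ)
    (hγ : IsTrajectory F h u γ) (huw : ∀ᵐ t ∂volume.restrict (Icc 0 h), u t = w t)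
    (hs : ∀ t ∈ Icc 0 h, γ t ∈ (extChartAt (𝓡 n) x₀).source)
    (hb : ∀ t ∈ Icc 0 h, extChartAt (𝓡 n) x₀ (γ t) ∈ Metric.ball (extChartAt (𝓡 n) x₀ x₀) ρ) :
    ∀ᵐ t : ℝ, t ∈ Ioo 0 h → HasDerivAt (fun t ↦ extChartAt (𝓡 n) x₀ (γ t))
      (H (w t) (extChartAt (𝓡 n) x₀ (γ t))) t := by
  filter_upwards [ae_mem_Icc_of_restrict hγ.2, ae_mem_Icc_of_restrict huw] with t h1 h2 ht
  have ht' := Ioo_subset_Icc_self ht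
  rw [hH.eq_inChart _ _ (hb t ht'), ← h2 ht]
  exact hasDerivAt_extChartAt_comp (hs t ht') (h1 ht)

/-- In a chart, trajectories solve the integral equation. -/
lemma integral_eq (hH : IsChartModel F K x₀ H H' C ρ) (hw : StronglyMeasurable w) (hh : 0 ≤ h)
    (hγ : IsTrajectory F h u γ) (huw : ∀ᵐ t ∂volume.restrict (Icc 0 h), u t = w t)
    (hs : ∀ t ∈ Icc 0 h, γ t ∈ (extChartAt (𝓡 n) x₀).source)
    (hb : ∀ t ∈ Icc 0 h, extChartAt (𝓡 n) x₀ (γ t) ∈ Metric.ball (extChartAt (𝓡 n) x₀ x₀) ρ) :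
    ∀ t ∈ Icc 0 h, extChartAt (𝓡 n) x₀ (γ t) = extChartAt (𝓡 n) x₀ (γ 0) +
      ∫ s in (0 : ℝ)..t, H (w s) (extChartAt (𝓡 n) x₀ (γ s)) := by
  refine eq_add_integral_of_ae_hasDerivAt (C := C) (hγ.1.2 x₀ 0 h le_rfl hh le_rfl hs) ?_
    (fun s _ ↦ hH.family.norm_le _ _) (hH.ae_hasDerivAt hγ huw hs hb)
  exact hH.family.continuous.comp_aestronglyMeasurable (hw.aestronglyMeasurable.prodMk
    (((hγ.continuousOn_extChartAt_comp hs).mono Ioc_subset_Icc_self).aestronglyMeasurable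
      measurableSet_Ioc))

/-- Solutions of the integral equation in a chart are trajectories. -/
lemma isTrajectory (hH : IsChartModel F K x₀ H H' C ρ) (hw : StronglyMeasurable w)
    {ξ : ℝ → EuclideanSpace ℝ (Fin n)} (hξ : ContinuousOn ξ (Icc 0 h))
    (hb : ∀ t ∈ Icc 0 h, ξ t ∈ Metric.ball (extChartAt (𝓡 n) x₀ x₀) ρ)
    (hξ' : ∀ t ∈ Icc 0 h, ξ t = ξ 0 + ∫ s in (0 : ℝ)..t, H (w s) (ξ s))
    (huw : ∀ᵐ t ∂volume.restrict (Icc 0 h), u t = w t) :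
    IsTrajectory F h u fun t ↦ (extChartAt (𝓡 n) x₀).symm (ξ t) := by
  have htgt : ∀ t ∈ Icc 0 h, ξ t ∈ (extChartAt (𝓡 n) x₀).target := fun t ht ↦
    hH.ball_subset (hb t ht)
  have hm : AEStronglyMeasurable (fun s ↦ H (w s) (ξ s)) (volume.restrict (Icc 0 h)) :=
    hH.family.continuous.comp_aestronglyMeasurable (hw.aestronglyMeasurable.prodMk
      (hξ.aestronglyMeasurable measurableSet_Icc))
  have hlip := hH.family.lipschitzOnWith_of_integral_eq hw hξ hξ'
  refine ⟨⟨(continuousOn_extChartAt_symm x₀).comp hξ htgt, fun x₁ a b ha hab hbh hs ↦ ?_⟩, ?_⟩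
  · have hsub : Icc a b ⊆ Icc 0 h := Icc_subset_Icc ha hbh
    -- Absolute continuity is required in every chart. Since `ξ` is Lipschitz and chart transitions
    -- are locally Lipschitz, compactness gives a Lipschitz bound in the chart at `x₁`.
    have hloc : LocallyLipschitzOn (Icc a b) fun t ↦
        extChartAt (𝓡 n) x₁ ((extChartAt (𝓡 n) x₀).symm (ξ t)) := by
      intro t ht
      obtain ⟨L, N, hN, hL⟩ := ((contDiffAt_transition (htgt t (hsub ht)) (hs t ht)).of_le
        (show (1 : ℕ∞ω) ≤ (∞ : ℕ∞ω) by simp)).exists_lipschitzOnWith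
      refine ⟨L * C, Icc a b ∩ ξ ⁻¹' N, Filter.inter_mem self_mem_nhdsWithin
        ((hξ.mono hsub t ht) hN), ?_⟩
      exact hL.comp (hlip.mono (inter_subset_left.trans hsub)) fun s hs ↦ hs.2
    obtain ⟨L, hL⟩ := hloc.exists_lipschitzOnWith_of_compact isCompact_Icc
    rw [← uIcc_of_le hab] at hL
    exact hL.absolutelyContinuousOnInterval
  · rcases lt_or_ge h 0 with hneg | hh
    · simp [Icc_eq_empty hneg.not_ge]
    have int : IntervalIntegrable (fun s ↦ H (w s) (ξ s)) volume 0 h :=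
      intervalIntegrable_of_bound (K := C) (by
        rw [uIoc_of_le hh]
        exact hm.mono_measure (Measure.restrict_mono Ioc_subset_Icc_self le_rfl))
        (fun s _ ↦ hH.family.norm_le _ _)
    have h3 : ∀ᵐ t : ℝ, t ≠ 0 := by simp [ae_iff, measure_singleton]
    have h4 : ∀ᵐ t : ℝ, t ≠ h := by simp [ae_iff, measure_singleton]
    have h5 := ae_mem_Icc_of_restrict huw
    rw [ae_restrict_iff' measurableSet_Icc]
    filter_upwards [int.ae_hasDerivAt_integral, h3, h4, h5] with t h1 h3 h4 h5 ht
    have hIoo : t ∈ Ioo 0 h := ⟨lt_of_le_of_ne ht.1 (Ne.symm h3), lt_of_le_of_ne ht.2 h4⟩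
    have h6 := ((h1 (by rwa [uIcc_of_le hh]) 0 (by simp)).const_add (ξ 0)).congr_of_eventuallyEq
      (f₁ := ξ) (by
        filter_upwards [isOpen_Ioo.mem_nhds hIoo] with s hs using hξ' s (Ioo_subset_Icc_self hs))
    rw [h5 hIoo]
    refine hasMFDerivAt_extChartAt_symm_comp (htgt t ht) ?_
    rwa [← hH.eq_inChart _ _ (hb t ht)]

/-- The backward flow along a short trajectory: a `C¹` local diffeomorphism that sends each point
near the end of the trajectory to a point from which it can be attained. -/
lemma exists_backward_flow (hH : IsChartModel F K x₀ H H' C ρ) (hw : StronglyMeasurable w)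
    (hh : 0 ≤ h) (hC : C * h ≤ 1 / 4) (hu : IsAdmissible 𝒰 U h u)
    (hγ : IsTrajectory F h u γ) (huw : ∀ᵐ t ∂volume.restrict (Icc 0 h), u t = w t)
    (hs : ∀ t ∈ Icc 0 h, γ t ∈ (extChartAt (𝓡 n) x₀).source)
    (hb : ∀ t ∈ Icc 0 h,
      extChartAt (𝓡 n) x₀ (γ t) ∈ Metric.ball (extChartAt (𝓡 n) x₀ x₀) (ρ / 2)) :
    ∃ Ψ : EuclideanSpace ℝ (Fin n) → EuclideanSpace ℝ (Fin n), ContDiff ℝ 1 Ψ ∧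
      (∀ z, Function.Injective (fderiv ℝ Ψ z)) ∧
      Ψ (extChartAt (𝓡 n) x₀ (γ h)) = extChartAt (𝓡 n) x₀ (γ 0) ∧
      ∀ᶠ z in 𝓝 (extChartAt (𝓡 n) x₀ (γ h)), (extChartAt (𝓡 n) x₀).symm z ∈
        attainableSet F U 𝒰 ((extChartAt (𝓡 n) x₀).symm (Ψ z)) := by
  have hρ := hH.pos
  set ζ : ℝ → EuclideanSpace ℝ (Fin n) := fun t ↦ extChartAt (𝓡 n) x₀ (γ t)
  have hζc : ContinuousOn ζ (Icc 0 h) := hγ.continuousOn_extChartAt_comp hs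
  have hζ : ∀ t ∈ Icc 0 h, ζ t = ζ 0 + ∫ s in (0 : ℝ)..t, H (w s) (ζ s) :=
    hH.integral_eq hw hh hγ huw hs fun t ht ↦ Metric.ball_subset_ball (by linarith) (hb t ht)
  -- The backward flow is the forward flow of the fields `-H` under the time-reversed control.
  have hw' : StronglyMeasurable fun τ ↦ w (h - τ) :=
    hw.comp_measurable (measurable_const.sub measurable_id)
  obtain ⟨ψ, ψc, ψi, ψl, ψd, ψinj⟩ := hH.family.neg.exists_flow hw' hh hC
  have hflip : ∀ t ∈ Icc 0 h, h - t ∈ Icc 0 h := fun t ht ↦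
    ⟨by linarith [ht.2], by linarith [ht.1]⟩
  have hζint : ∀ a b, a ∈ Icc 0 h → b ∈ Icc 0 h →
      IntervalIntegrable (fun s ↦ H (w s) (ζ s)) volume a b := fun a b ha hb ↦
    hH.family.intervalIntegrable hw
      ((hζc.mono (uIoc_subset_uIcc.trans (uIcc_subset_Icc ha hb))).aestronglyMeasurable
        measurableSet_uIoc)
  -- The reversed trajectory solves the reversed equation from `ζ h`, so uniqueness identifies it
  -- with the flow line.
  have hrev : EqOn (ψ (ζ h)) (fun τ ↦ ζ (h - τ)) (Icc 0 h) := by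
    refine hH.family.neg.eqOn hw' hC (ψc _).continuousOn
      (hζc.comp (by fun_prop) hflip) (ψi _) fun τ hτ ↦ ?_
    have e := intervalIntegral.integral_comp_sub_left (a := 0) (b := τ)
      (fun s ↦ -H (w s) (ζ s)) h
    rw [e, sub_zero, intervalIntegral.integral_neg, hζ h ⟨hh, le_rfl⟩, hζ _ (hflip τ hτ),
      ← intervalIntegral.integral_add_adjacent_intervals
        (hζint 0 (h - τ) ⟨le_rfl, hh⟩ (hflip τ hτ)) (hζint (h - τ) h (hflip τ hτ) ⟨hh, le_rfl⟩)]
    abel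
  refine ⟨fun z ↦ ψ z h, ψd h ⟨hh, le_rfl⟩, ψinj h ⟨hh, le_rfl⟩, ?_, ?_⟩
  · simpa only [sub_self] using hrev ⟨hh, le_rfl⟩
  -- The flow is `2`-Lipschitz, so starting within `ρ / 4` of `ζ h` keeps the curve within `ρ / 2`
  -- of the trajectory, which itself lies within `ρ / 2` of the centre.
  filter_upwards [Metric.ball_mem_nhds (ζ h) (show 0 < ρ / 4 by positivity)] with z hz
  have hball : ∀ τ ∈ Icc 0 h, ψ z τ ∈ Metric.ball (extChartAt (𝓡 n) x₀ x₀) ρ := by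
    intro τ hτ
    have h1 := ψl τ hτ z (ζ h)
    rw [hrev hτ, ← dist_eq_norm, ← dist_eq_norm] at h1
    have h2 := hb _ (hflip τ hτ)
    rw [Metric.mem_ball] at h2 hz ⊢
    have h3 := dist_triangle (ψ z τ) (ζ (h - τ)) (extChartAt (𝓡 n) x₀ x₀)
    linarith
  have hint : ∀ a b, IntervalIntegrable (fun s ↦ -H (w (h - s)) (ψ z s)) volume a b := fun a b ↦
    hH.family.neg.intervalIntegrable hw' (ψc z).aestronglyMeasurable
  refine ⟨h, u, fun t ↦ (extChartAt (𝓡 n) x₀).symm (ψ z (h - t)), hh, hu,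
    hH.isTrajectory hw (((ψc z).comp (by fun_prop)).continuousOn)
      (fun t ht ↦ hball _ (hflip t ht)) (fun t ht ↦ ?_) huw, by simp, ?_⟩
  · have e := intervalIntegral.integral_comp_sub_left (a := 0) (b := t)
      (fun s ↦ H (w (h - s)) (ψ z s)) h
    simp only [sub_sub_cancel, sub_zero] at e ⊢
    rw [e, ψi z _ (hflip t ht), ψi z h ⟨hh, le_rfl⟩,
      ← intervalIntegral.integral_add_adjacent_intervals (hint 0 (h - t)) (hint (h - t) h),
      intervalIntegral.integral_neg (a := h - t)]
    abel
  · have := ψi z 0 ⟨le_rfl, hh⟩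
    simp only [intervalIntegral.integral_same, add_zero] at this
    simp [this]

end IsChartModel

end ChartModel

/-! ### Joint differentiability of an autonomous flow in position and time -/

section TimeScaled

variable {E : Type*} [NormedAddCommGroup E] [NormedSpace ℝ E]

/-- The extended system whose second, constant, component rescales the speed of the first. -/
lemma IsBoundedC1Family.sin_smul {P : Type*} [TopologicalSpace P] {H : P → E → E}
    {H' : P → E → E →L[ℝ] E} {C : ℝ≥0} (hH : IsBoundedC1Family H H' C) (v : P) :
    IsBoundedC1Family (fun (_ : Unit) (q : E × ℝ) ↦ (Real.sin q.2 • H v q.1, (0 : ℝ)))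
      (fun _ q ↦ (Real.sin q.2 • (H' v q.1).comp (ContinuousLinearMap.fst ℝ E ℝ) +
        (Real.cos q.2 • ContinuousLinearMap.snd ℝ E ℝ).smulRight (H v q.1)).prod 0) (C + C) where
  continuous := by
    have h1 : Continuous fun q : Unit × E × ℝ ↦ H v q.2.1 :=
      hH.continuous.comp (continuous_const.prodMk (by fun_prop))
    exact ((Real.continuous_sin.comp (by fun_prop)).smul h1).prodMk continuous_const
  continuous_deriv := by
    have h1 : Continuous fun q : Unit × E × ℝ ↦ H v q.2.1 :=
      hH.continuous.comp (continuous_const.prodMk (by fun_prop))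
    have h2 : Continuous fun q : Unit × E × ℝ ↦ H' v q.2.1 :=
      hH.continuous_deriv.comp (continuous_const.prodMk (by fun_prop))
    have h3 : Continuous fun q : Unit × E × ℝ ↦
        Real.cos q.2.2 • ContinuousLinearMap.snd ℝ E ℝ :=
      (Real.continuous_cos.comp (by fun_prop)).smul continuous_const
    have h4 : Continuous fun q : Unit × E × ℝ ↦ Real.sin q.2.2 :=
      Real.continuous_sin.comp (by fun_prop)
    have h5 := isBoundedBilinearMap_smulRight.continuous.comp (h3.prodMk h1)
    have h6 : Continuous fun q : Unit × E × ℝ ↦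
        Real.sin q.2.2 • (H' v q.2.1).comp (ContinuousLinearMap.fst ℝ E ℝ) :=
      h4.smul (h2.clm_comp continuous_const)
    exact (ContinuousLinearMap.prodₗᵢ (𝕜 := ℝ) (E := E × ℝ) (F := E) (G := ℝ) ℝ).continuous.comp
      ((h6.add h5).prodMk continuous_const)
  hasFDerivAt _ q := by
    have h1 : HasFDerivAt (fun q : E × ℝ ↦ H v q.1)
        ((H' v q.1).comp (ContinuousLinearMap.fst ℝ E ℝ)) q :=
      (hH.hasFDerivAt v q.1).comp q hasFDerivAt_fst
    exact (hasFDerivAt_snd.sin.smul h1).prodMk (hasFDerivAt_const 0 q)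
  norm_le _ q := by
    rw [Prod.norm_mk, norm_zero, norm_smul, Real.norm_eq_abs]
    have h1 := hH.norm_le v q.1
    have h2 := Real.abs_sin_le_one q.2
    push_cast
    refine max_le ?_ (by positivity)
    nlinarith [norm_nonneg (H v q.1), abs_nonneg (Real.sin q.2)]
  norm_deriv_le _ q := by
    push_cast
    refine ContinuousLinearMap.opNorm_le_bound _ (by positivity) fun p ↦ ?_
    have h1 := (H' v q.1).le_of_opNorm_le (hH.norm_deriv_le v q.1) p.1
    have h2 := hH.norm_le v q.1
    have h3 := Real.abs_sin_le_one q.2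
    have h4 := Real.abs_cos_le_one q.2
    have h5 := norm_fst_le p
    have h6 := norm_snd_le p
    have h0 : (0 : ℝ) ≤ C := C.2
    simp only [ContinuousLinearMap.prod_apply, _root_.add_apply, _root_.smul_apply,
      ContinuousLinearMap.comp_apply, ContinuousLinearMap.coe_fst', ContinuousLinearMap.coe_snd',
      ContinuousLinearMap.smulRight_apply, _root_.zero_apply, Prod.norm_mk, norm_zero]
    refine max_le ((norm_add_le _ _).trans ?_) (by positivity)
    rw [add_mul]
    refine add_le_add ?_ ?_
    · rw [norm_smul, Real.norm_eq_abs]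
      calc _ ≤ 1 * (C * ‖p.1‖) := mul_le_mul h3 h1 (norm_nonneg _) zero_le_one
        _ ≤ C * ‖p‖ := by rw [one_mul]; gcongr
    · rw [norm_smul, smul_eq_mul, norm_mul, Real.norm_eq_abs]
      calc _ ≤ 1 * ‖p‖ * C := by gcongr
        _ = C * ‖p‖ := by ring

/-- The flow of an autonomous vector field is `C¹` in the position and the time together. -/
lemma IsBoundedC1Family.exists_timeScaled_flow [CompleteSpace E] {P : Type*} [TopologicalSpace P]
    {H : P → E → E} {H' : P → E → E →L[ℝ] E} {C : ℝ≥0} (hH : IsBoundedC1Family H H' C) (v : P) :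
    ∃ h > 0, ∃ ψ : E × ℝ → ℝ → E, (∀ q, Continuous (ψ q)) ∧
      (∀ q, ∀ t ∈ Icc 0 h, ψ q t = q.1 + ∫ s in (0 : ℝ)..t, Real.sin q.2 • H v (ψ q s)) ∧
      (∀ t ∈ Icc 0 h, ∀ q q', ‖ψ q t - ψ q' t‖ ≤ 2 * ‖q - q'‖) ∧
      ContDiff ℝ 1 (fun q ↦ ψ q h) ∧
      ∀ z w s, fderiv ℝ (fun q ↦ ψ q h) (z, 0) (w, s) = w + s • h • H v z := by
  -- `C + C` is the bound of the extended family; adding `1` covers `C = 0`.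
  set h : ℝ := 1 / (4 * (C + C + 1)) with hdef
  have hC0 : (0 : ℝ) ≤ C := C.2
  have hpos : 0 < h := by positivity
  have hC : ((C + C : ℝ≥0) : ℝ) * h ≤ 1 / 4 := by
    push_cast
    rw [hdef, mul_one_div, div_le_div_iff₀ (by positivity) (by norm_num)]
    linarith
  -- The speed is `sin` of the parameter: it keeps the extended field globally bounded, vanishes
  -- with slope one at `0`, and is negative for small negative parameters, which gives motion
  -- backwards in time.
  obtain ⟨ψ, ψc, ψi, ψl, ψd, -⟩ := (hH.sin_smul v).exists_flow (u := fun _ ↦ ())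
    stronglyMeasurable_const hpos.le hC
  have int : ∀ q a b, IntervalIntegrable
      (fun s ↦ (Real.sin (ψ q s).2 • H v (ψ q s).1, (0 : ℝ))) volume a b := fun q a b ↦
    (hH.sin_smul v).intervalIntegrable (u := fun _ ↦ ()) stronglyMeasurable_const
      (ψc q).aestronglyMeasurable
  have snd : ∀ q, ∀ t ∈ Icc 0 h, (ψ q t).2 = q.2 := fun q t ht ↦ by
    have := congrArg (ContinuousLinearMap.snd ℝ E ℝ) (ψi q t ht)
    rw [map_add, ← ContinuousLinearMap.intervalIntegral_comp_comm _ (int q 0 t)] at this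
    simpa using this
  have fst : ∀ q, ∀ t ∈ Icc 0 h,
      (ψ q t).1 = q.1 + ∫ s in (0 : ℝ)..t, Real.sin q.2 • H v (ψ q s).1 := fun q t ht ↦ by
    have := congrArg (ContinuousLinearMap.fst ℝ E ℝ) (ψi q t ht)
    rw [map_add, ← ContinuousLinearMap.intervalIntegral_comp_comm _ (int q 0 t)] at this
    simp only [ContinuousLinearMap.coe_fst'] at this
    rw [this]
    congr 1
    refine intervalIntegral.integral_congr fun s hs ↦ ?_
    rw [uIcc_of_le ht.1] at hs
    simp only [snd q s ⟨hs.1, hs.2.trans ht.2⟩]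
  have lip : ∀ t ∈ Icc 0 h, ∀ q q', ‖(ψ q t).1 - (ψ q' t).1‖ ≤ 2 * ‖q - q'‖ := fun t ht q q' ↦
    (norm_fst_le (ψ q t - ψ q' t)).trans (ψl t ht q q')
  have hh : h ∈ Icc 0 h := ⟨hpos.le, le_rfl⟩
  have hd : ContDiff ℝ 1 fun q ↦ (ψ q h).1 := contDiff_fst.comp (ψd h hh)
  refine ⟨h, hpos, fun q t ↦ (ψ q t).1, fun q ↦ (ψc q).fst, fst, lip, hd, fun z w s ↦ ?_⟩
  have hfd : HasFDerivAt (fun q ↦ (ψ q h).1) (fderiv ℝ (fun q ↦ (ψ q h).1) (z, 0)) (z, 0) :=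
    (hd.differentiable (by simp) _).hasFDerivAt
  have hrest : ∀ z, ∀ t ∈ Icc 0 h, (ψ (z, 0) t).1 = z := fun z t ht ↦ by
    rw [fst _ t ht]; simp
  have d1 : fderiv ℝ (fun q ↦ (ψ q h).1) (z, 0) (w, 0) = w := by
    have e1 : HasFDerivAt (fun x : E ↦ (ψ (x, 0) h).1)
        ((fderiv ℝ (fun q ↦ (ψ q h).1) (z, 0)).comp (ContinuousLinearMap.inl ℝ E ℝ)) z :=
      HasFDerivAt.comp (g := fun q ↦ (ψ q h).1) z hfd (hasFDerivAt_prodMk_left z (0 : ℝ))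
    have e2 : HasFDerivAt (fun x : E ↦ (ψ (x, 0) h).1) (ContinuousLinearMap.id ℝ E) z := by
      have : (fun x : E ↦ (ψ (x, 0) h).1) = id := funext fun x ↦ hrest x h hh
      rw [this]
      exact hasFDerivAt_id z
    simpa using DFunLike.congr_fun (e1.unique e2) w
  have d2 : fderiv ℝ (fun q ↦ (ψ q h).1) (z, 0) (0, 1) = h • H v z := by
    have e1 : HasFDerivAt (fun σ : ℝ ↦ (ψ (z, σ) h).1)
        ((fderiv ℝ (fun q ↦ (ψ q h).1) (z, 0)).comp (ContinuousLinearMap.inr ℝ E ℝ)) 0 :=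
      HasFDerivAt.comp (g := fun q ↦ (ψ q h).1) 0 hfd (hasFDerivAt_prodMk_right z (0 : ℝ))
    -- The displacement is `sin σ • c σ`, so its slope at `0` is that of `sin` times `c σ`, and only
    -- the limit of `c` at `0` is needed.
    let c : ℝ → E := fun σ ↦ ∫ s in (0 : ℝ)..h, H v (ψ (z, σ) s).1
    have hc : Filter.Tendsto c (𝓝[≠] 0) (𝓝 (h • H v z)) := by
      refine Filter.Tendsto.mono_left ?_ nhdsWithin_le_nhds
      rw [tendsto_iff_norm_sub_tendsto_zero]
      have hi : ∀ σ, IntervalIntegrable (fun s ↦ H v (ψ (z, σ) s).1) volume 0 h := fun σ ↦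
        (hH.continuous.comp (continuous_const.prodMk (ψc (z, σ)).fst)).intervalIntegrable _ _
      refine squeeze_zero (fun _ ↦ norm_nonneg _) (g := fun σ ↦ h * (C * (2 * |σ|)))
        (fun σ ↦ ?_) ?_
      · have : h • H v z = ∫ s in (0 : ℝ)..h, H v z := by simp
        rw [this, ← intervalIntegral.integral_sub (hi σ) (by simp)]
        refine norm_integral_le_of_Icc hh (by positivity) fun s hs ↦ ?_
        rw [← dist_eq_norm]
        refine ((hH.lipschitzWith v).dist_le_mul _ _).trans ?_
        gcongr
        have := lip s hs (z, σ) (z, 0)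
        rw [hrest z s hs] at this
        rw [dist_eq_norm]
        refine this.trans (le_of_eq ?_)
        simp [Prod.norm_def]
      · have : Continuous fun σ : ℝ ↦ h * (C * (2 * |σ|)) := by fun_prop
        simpa using this.tendsto 0
    have e2 : HasDerivAt (fun σ : ℝ ↦ (ψ (z, σ) h).1) (h • H v z) 0 := by
      rw [hasDerivAt_iff_tendsto_slope]
      have hs := (hasDerivAt_iff_tendsto_slope.1 (Real.hasDerivAt_sin 0)).smul hc
      rw [Real.cos_zero, one_smul] at hs
      refine hs.congr fun σ ↦ ?_
      simp only [slope, vsub_eq_sub, sub_zero, Real.sin_zero, fst _ h hh, zero_smul,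
        intervalIntegral.integral_zero, add_zero, add_sub_cancel_left,
        intervalIntegral.integral_smul, c, smul_eq_mul, mul_smul]
    have := e1.hasDerivAt.unique e2
    simpa using this
  have : ((w, s) : E × ℝ) = (w, 0) + s • (0, 1) := by simp
  rw [this, map_add, map_smul, d1, d2]

end TimeScaled

/-! ### Immersions as local sections -/

section Immersion

variable {V E : Type*} [NormedAddCommGroup V] [NormedSpace ℝ V] [FiniteDimensional ℝ V]
  [NormedAddCommGroup E] [NormedSpace ℝ E] [FiniteDimensional ℝ E]

/-- An immersion is, locally and up to a reparametrization, a section of a linear projection. -/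
lemma exists_section_of_immersion {Φ : V → E} {t₀ : V} (hΦ : ContDiffAt ℝ 1 Φ t₀)
    (hinj : Function.Injective (fderiv ℝ Φ t₀)) :
    ∃ (L : E →L[ℝ] V) (σ : V → E), σ (L (Φ t₀)) = Φ t₀ ∧ ContDiffAt ℝ 1 σ (L (Φ t₀)) ∧
      (∀ᶠ y in 𝓝 (L (Φ t₀)), L (σ y) = y) ∧
      ∀ Q : E → Prop, (∀ᶠ t in 𝓝 t₀, Q (Φ t)) → ∀ᶠ y in 𝓝 (L (Φ t₀)), Q (σ y) := by
  -- With `L` a left inverse of the derivative, `L ∘ Φ` has derivative the identity and so a local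
  -- inverse `θ`; the section is `Φ ∘ θ`.
  obtain ⟨L₀, hL₀⟩ := (fderiv ℝ Φ t₀).toLinearMap.exists_leftInverse_of_injective
    (LinearMap.ker_eq_bot.2 hinj)
  let L : E →L[ℝ] V := L₀.toContinuousLinearMap
  have hL : L.comp (fderiv ℝ Φ t₀) = ContinuousLinearMap.id ℝ V :=
    ContinuousLinearMap.ext fun x ↦ DFunLike.congr_fun hL₀ x
  have hf : ContDiffAt ℝ 1 (fun t ↦ L (Φ t)) t₀ := L.contDiff.contDiffAt.comp t₀ hΦ
  have hf' : HasFDerivAt (fun t ↦ L (Φ t))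
      ((ContinuousLinearEquiv.refl ℝ V : V ≃L[ℝ] V) : V →L[ℝ] V) t₀ := by
    have := L.hasFDerivAt.comp t₀ (hΦ.differentiableAt (by simp)).hasFDerivAt
    rw [hL] at this
    exact this
  let θ := hf.localInverse hf' (by simp)
  have hθ : ContDiffAt ℝ 1 θ (L (Φ t₀)) := hf.to_localInverse hf' (by simp)
  have hθ0 : θ (L (Φ t₀)) = t₀ := hf.localInverse_apply_image hf' (by simp)
  have hθc : Filter.Tendsto θ (𝓝 (L (Φ t₀))) (𝓝 t₀) := by
    simpa [hθ0] using hθ.continuousAt.tendsto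
  refine ⟨L, fun y ↦ Φ (θ y), congrArg Φ hθ0, ?_, ?_, fun Q hQ ↦ hθc.eventually hQ⟩
  · exact ContDiffAt.comp (g := Φ) _ (by rwa [hθ0]) hθ
  · exact (hf.hasStrictFDerivAt' hf' (by simp)).eventually_right_inverse

end Immersion

/-! ### Immersed `C¹` disks in a subset of the manifold -/

section Disk

variable {n m : ℕ} {M : Type*} [TopologicalSpace M] [ChartedSpace (EuclideanSpace ℝ (Fin n)) M]

/-- The point `p` lies on a `k`-dimensional `C¹` disk immersed in `B`. -/
def HasImmersedDisk (n : ℕ) {M : Type*} [TopologicalSpace M]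
    [ChartedSpace (EuclideanSpace ℝ (Fin n)) M] (B : Set M) (k : ℕ) (p : M) : Prop :=
  ∃ x₀ : M, p ∈ (extChartAt (𝓡 n) x₀).source ∧
    ∃ Φ : (Fin k → ℝ) → EuclideanSpace ℝ (Fin n), ContDiffAt ℝ 1 Φ 0 ∧
      Function.Injective (fderiv ℝ Φ 0) ∧ Φ 0 = extChartAt (𝓡 n) x₀ p ∧
      ∀ᶠ t in 𝓝 0, (extChartAt (𝓡 n) x₀).symm (Φ t) ∈ B

variable {B : Set M} {k : ℕ} {p : M}

/-- The parameter space and the base point are arbitrary so that a disk can be swept over `V × ℝ`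
and recentred at a nearby parameter. -/
lemma hasImmersedDisk_of_immersion {V : Type*} [NormedAddCommGroup V] [NormedSpace ℝ V]
    [FiniteDimensional ℝ V] (hV : Module.finrank ℝ V = k) {x₀ : M}
    {Φ : V → EuclideanSpace ℝ (Fin n)} {t₀ : V} (ht : Φ t₀ ∈ (extChartAt (𝓡 n) x₀).target)
    (hΦ : ContDiffAt ℝ 1 Φ t₀) (hinj : Function.Injective (fderiv ℝ Φ t₀))
    (hB : ∀ᶠ t in 𝓝 t₀, (extChartAt (𝓡 n) x₀).symm (Φ t) ∈ B) :
    HasImmersedDisk n B k ((extChartAt (𝓡 n) x₀).symm (Φ t₀)) := by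
  let L : (Fin k → ℝ) ≃L[ℝ] V := ContinuousLinearEquiv.ofFinrankEq (by simp [hV])
  let a : (Fin k → ℝ) → V := fun s ↦ t₀ + L s
  have ha0 : a 0 = t₀ := by simp [a]
  have ha : HasFDerivAt a (L : (Fin k → ℝ) →L[ℝ] V) 0 := L.hasFDerivAt.const_add t₀
  have hac : ContDiff ℝ 1 a := contDiff_const.add L.contDiff
  have hΦ' : ContDiffAt ℝ 1 Φ (a 0) := by rwa [ha0]
  refine ⟨x₀, (extChartAt (𝓡 n) x₀).map_target ht, fun s ↦ Φ (a s),
    hΦ'.comp 0 hac.contDiffAt, ?_, ?_, ?_⟩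
  · have h1 := (hΦ'.differentiableAt (by simp)).hasFDerivAt.comp 0 ha
    rw [show fderiv ℝ (fun s ↦ Φ (a s)) 0 = _ from h1.fderiv, ha0]
    exact hinj.comp L.injective
  · rw [(extChartAt (𝓡 n) x₀).right_inv ht]
    exact congrArg Φ ha0
  · have : Filter.Tendsto a (𝓝 0) (𝓝 t₀) := by simpa [ha0] using hac.continuous.tendsto 0
    exact this.eventually hB

namespace HasImmersedDisk

lemma mem (h : HasImmersedDisk n B k p) : p ∈ B := by
  obtain ⟨x₀, hp, Φ, -, -, h0, hB⟩ := h
  have := hB.self_of_nhds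
  rwa [h0, (extChartAt (𝓡 n) x₀).left_inv hp] at this

/-- This bound on the dimension ensures that a maximal one exists. -/
lemma le (h : HasImmersedDisk n B k p) : k ≤ n := by
  obtain ⟨x₀, hp, Φ, -, hinj, -⟩ := h
  have := LinearMap.finrank_le_finrank_of_injective (f := (fderiv ℝ Φ 0).toLinearMap) hinj
  simpa using this

lemma zero (hp : p ∈ B) : HasImmersedDisk n B 0 p :=
  ⟨p, mem_extChartAt_source p, fun _ ↦ extChartAt (𝓡 n) p p, contDiffAt_const,
    Function.injective_of_subsingleton _, rfl, Filter.Eventually.of_forall fun _ ↦ by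
      rwa [extChartAt_to_inv]⟩

/-- Immersed disks can be read in any chart. -/
lemma exists_in_chart [IsManifold (𝓡 n) ∞ M] (h : HasImmersedDisk n B k p) {x₁ : M}
    (hp₁ : p ∈ (extChartAt (𝓡 n) x₁).source) :
    ∃ Φ : (Fin k → ℝ) → EuclideanSpace ℝ (Fin n), ContDiffAt ℝ 1 Φ 0 ∧
      Function.Injective (fderiv ℝ Φ 0) ∧ Φ 0 = extChartAt (𝓡 n) x₁ p ∧
      ∀ᶠ t in 𝓝 0, (extChartAt (𝓡 n) x₁).symm (Φ t) ∈ B := by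
  obtain ⟨x₀, hp, Φ, hΦ, hinj, h0, hB⟩ := h
  let τ : EuclideanSpace ℝ (Fin n) → EuclideanSpace ℝ (Fin n) := fun z ↦
    extChartAt (𝓡 n) x₁ ((extChartAt (𝓡 n) x₀).symm z)
  let τ' : EuclideanSpace ℝ (Fin n) → EuclideanSpace ℝ (Fin n) := fun z ↦
    extChartAt (𝓡 n) x₀ ((extChartAt (𝓡 n) x₁).symm z)
  have ht0 : Φ 0 ∈ (extChartAt (𝓡 n) x₀).target := h0 ▸ (extChartAt (𝓡 n) x₀).map_source hp
  have hs0 : (extChartAt (𝓡 n) x₀).symm (Φ 0) = p := by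
    rw [h0, (extChartAt (𝓡 n) x₀).left_inv hp]
  have hτ0 : τ (Φ 0) = extChartAt (𝓡 n) x₁ p := by simp only [τ, hs0]
  have hτ : ContDiffAt ℝ ∞ τ (Φ 0) := contDiffAt_transition ht0 (by rwa [hs0])
  have hτ' : ContDiffAt ℝ ∞ τ' (τ (Φ 0)) := by
    rw [hτ0]
    refine contDiffAt_transition ((extChartAt (𝓡 n) x₁).map_source hp₁) ?_
    rwa [(extChartAt (𝓡 n) x₁).left_inv hp₁]
  have hev : ∀ᶠ z in 𝓝 (Φ 0), z ∈ (extChartAt (𝓡 n) x₀).target ∧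
      (extChartAt (𝓡 n) x₀).symm z ∈ (extChartAt (𝓡 n) x₁).source := by
    refine Filter.Eventually.and ((isOpen_extChartAt_target x₀).mem_nhds ht0) ?_
    have hc : ContinuousAt (extChartAt (𝓡 n) x₀).symm (Φ 0) :=
      (continuousOn_extChartAt_symm x₀).continuousAt
        ((isOpen_extChartAt_target x₀).mem_nhds ht0)
    exact hc.preimage_mem_nhds ((isOpen_extChartAt_source x₁).mem_nhds (by rwa [hs0]))
  have hd := (hτ.differentiableAt (by simp)).hasFDerivAt
  have hd' := (hτ'.differentiableAt (by simp)).hasFDerivAt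
  -- The transition maps are inverse to each other near `Φ 0`, so `fderiv ℝ τ (Φ 0)` is injective
  -- and immersions are preserved.
  have hcomp : (fderiv ℝ τ' (τ (Φ 0))).comp (fderiv ℝ τ (Φ 0)) = ContinuousLinearMap.id ℝ _ := by
    refine (hd'.comp (Φ 0) hd).unique ((hasFDerivAt_id (Φ 0)).congr_of_eventuallyEq ?_)
    filter_upwards [hev] with z hz
    simp only [τ, τ', Function.comp_apply, id_eq, (extChartAt (𝓡 n) x₁).left_inv hz.2,
      (extChartAt (𝓡 n) x₀).right_inv hz.1]
  have hΦd := (hΦ.differentiableAt (by simp)).hasFDerivAt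
  refine ⟨fun t ↦ τ (Φ t), (hτ.of_le (by simp)).comp 0 hΦ, ?_, hτ0, ?_⟩
  · rw [show fderiv ℝ (fun t ↦ τ (Φ t)) 0 = _ from (hd.comp 0 hΦd).fderiv]
    have : Function.Injective (fderiv ℝ τ (Φ 0)) :=
      Function.LeftInverse.injective (g := fderiv ℝ τ' (τ (Φ 0)))
        fun x ↦ DFunLike.congr_fun hcomp x
    exact this.comp hinj
  · filter_upwards [hB, hΦ.continuousAt.eventually hev] with t h1 h2
    simpa only [τ, (extChartAt (𝓡 n) x₁).left_inv h2.2] using h1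

end HasImmersedDisk

end Disk

/-! ### Propagation of immersed disks along trajectories -/

section Propagation

variable {n m : ℕ} {M : Type*} [TopologicalSpace M] [ChartedSpace (EuclideanSpace ℝ (Fin n)) M]
  {F : (x : M) → EuclideanSpace ℝ (Fin m) → TangentSpace (𝓡 n) x}
  {U : Set (EuclideanSpace ℝ (Fin m))} {h T : ℝ} {u : ℝ → EuclideanSpace ℝ (Fin m)} {γ : ℝ → M}
  {K : Set (EuclideanSpace ℝ (Fin m))} {x₀ : M}
  {H : K → EuclideanSpace ℝ (Fin n) → EuclideanSpace ℝ (Fin n)}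
  {H' : K → EuclideanSpace ℝ (Fin n) → EuclideanSpace ℝ (Fin n) →L[ℝ] EuclideanSpace ℝ (Fin n)}
  {C : ℝ≥0} {ρ : ℝ} {w : ℝ → K} {𝒰 : ControlClass} {B : Set M} {k : ℕ}

lemma isAdmissible_const {v : EuclideanSpace ℝ (Fin m)} (hv : v ∈ U) (hT : 0 ≤ T) :
    IsAdmissible 𝒰 U T fun _ ↦ v := by
  cases 𝒰 with
  | piecewiseConstant =>
    refine ⟨fun _ _ ↦ hv, 1, fun i ↦ if i = 0 then 0 else T, fun i j hij ↦ ?_, by simp, by simp,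
      fun i _ ↦ ⟨v, hv, fun _ _ ↦ rfl⟩⟩
    dsimp only
    split_ifs with h1 h2
    · exact le_rfl
    · exact hT
    · omega
    · exact le_rfl
  | essentiallyBounded =>
    exact isEssentiallyBoundedControl_iff.2 ⟨aestronglyMeasurable_const, ‖v‖,
      Filter.Eventually.of_forall fun _ ↦ ⟨hv, le_rfl⟩⟩

lemma IsTrajectory.eventually_chart (hγ : IsTrajectory F T u γ) {c : ℝ} (hc : c ∈ Icc 0 T)
    {N : Set (EuclideanSpace ℝ (Fin n))} (hN : N ∈ 𝓝 (extChartAt (𝓡 n) (γ c) (γ c))) :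
    ∀ᶠ t in 𝓝[Icc 0 T] c, γ t ∈ (extChartAt (𝓡 n) (γ c)).source ∧
      extChartAt (𝓡 n) (γ c) (γ t) ∈ N :=
  (hγ.1.1 c hc).eventually (Filter.Eventually.and (extChartAt_source_mem_nhds (γ c))
    ((continuousAt_extChartAt (γ c)).preimage_mem_nhds hN))

variable [IsManifold (𝓡 n) ∞ M]

/-- Integral curves of a vector field of the system, run backwards at constant positive speed, join
points of the attainable sets. -/
lemma IsChartModel.symm_mem_attainableSet_of_timeReversed (hH : IsChartModel F K x₀ H H' C ρ)
    (hKU : K ⊆ U) (v : K) {κ : ℝ} (hpos : 0 < h) (hκ0 : 0 < κ)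
    {c : ℝ → EuclideanSpace ℝ (Fin n)} (hc : Continuous c)
    (hci : ∀ s ∈ Icc 0 h, c s = c 0 - κ • ∫ r in (0 : ℝ)..s, H v (c r))
    (hb : ∀ s ∈ Icc 0 h, c s ∈ Metric.ball (extChartAt (𝓡 n) x₀ x₀) ρ) :
    (extChartAt (𝓡 n) x₀).symm (c 0) ∈
      attainableSet F U 𝒰 ((extChartAt (𝓡 n) x₀).symm (c h)) := by
  have hmem : ∀ t ∈ Icc 0 (h * κ), h - t / κ ∈ Icc 0 h := fun t ht ↦ by
    have h1 : t / κ ≤ h := (div_le_iff₀ hκ0).2 ht.2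
    have h2 : 0 ≤ t / κ := div_nonneg ht.1 hκ0.le
    exact ⟨by linarith, by linarith⟩
  have hT : 0 ≤ h * κ := by positivity
  have hHc : Continuous fun s ↦ H v (c s) :=
    hH.family.continuous.comp (continuous_const.prodMk hc)
  -- The substitution `t ↦ h - t / κ` reverses the curve and restores unit speed, whence the
  -- duration `h * κ`.
  refine ⟨h * κ, fun _ ↦ v, fun t ↦ (extChartAt (𝓡 n) x₀).symm (c (h - t / κ)), hT,
    isAdmissible_const (hKU v.2) hT, hH.isTrajectory (w := fun _ ↦ v) stronglyMeasurable_const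
      ((hc.comp (by fun_prop)).continuousOn) (fun t ht ↦ hb _ (hmem t ht))
      (fun t ht ↦ ?_) (Filter.Eventually.of_forall fun _ ↦ rfl), by simp, ?_⟩
  · have e := intervalIntegral.integral_comp_sub_div (a := 0) (b := t)
      (fun s ↦ H v (c s)) hκ0.ne' h
    rw [e, zero_div, sub_zero, hci _ (hmem t ht), hci h ⟨hpos.le, le_rfl⟩,
      ← intervalIntegral.integral_add_adjacent_intervals (hHc.intervalIntegrable 0 (h - t / κ))
        (hHc.intervalIntegrable (h - t / κ) h)]
    simp only [smul_add]
    abel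
  · have e0 : h - h * κ / κ = 0 := by field_simp; ring
    simp only [e0]

/-- If some vector field of the system is transverse to a disk immersed in a set that is invariant
in backward time, then that set contains immersed disks of larger dimension. -/
lemma exists_hasImmersedDisk_succ (hKU : K ⊆ U) (hH : IsChartModel F K x₀ H H' C ρ) (v : K)
    (hB : ∀ p q, q ∈ attainableSet F U 𝒰 p → q ∈ B → p ∈ B)
    {V : Type*} [NormedAddCommGroup V] [NormedSpace ℝ V] [FiniteDimensional ℝ V]
    {Φ : V → EuclideanSpace ℝ (Fin n)} {t₀ : V} (hΦ : ContDiffAt ℝ 1 Φ t₀)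
    (hinj : Function.Injective (fderiv ℝ Φ t₀))
    (hball : Φ t₀ ∈ Metric.ball (extChartAt (𝓡 n) x₀ x₀) ρ)
    (hev : ∀ᶠ t in 𝓝 t₀, (extChartAt (𝓡 n) x₀).symm (Φ t) ∈ B)
    (hv : ∀ y, fderiv ℝ Φ t₀ y ≠ H v (Φ t₀)) :
    ∃ p, HasImmersedDisk n B (Module.finrank ℝ V + 1) p := by
  obtain ⟨h, hpos, ψ, ψc, ψi, ψl, ψd, ψD⟩ := hH.family.exists_timeScaled_flow v
  have hh : h ∈ Icc 0 h := ⟨hpos.le, le_rfl⟩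
  let a : V × ℝ → EuclideanSpace ℝ (Fin n) × ℝ := fun q ↦ (Φ q.1, q.2)
  have ha : ContDiffAt ℝ 1 a (t₀, 0) :=
    (ContDiffAt.comp (g := Φ) (t₀, (0 : ℝ)) hΦ contDiffAt_fst).prodMk contDiffAt_snd
  have ha' : HasFDerivAt a (((fderiv ℝ Φ t₀).comp (ContinuousLinearMap.fst ℝ V ℝ)).prod
      (ContinuousLinearMap.snd ℝ V ℝ)) (t₀, 0) :=
    (HasFDerivAt.comp (g := Φ) (t₀, (0 : ℝ)) (hΦ.differentiableAt (by simp)).hasFDerivAt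
      hasFDerivAt_fst).prodMk hasFDerivAt_snd
  -- `G` sweeps the disk along the field. At `(t₀, 0)` its derivative adds the direction `H v (Φ
  -- t₀)` to the tangent space of the disk, and transversality makes it injective.
  let G : V × ℝ → EuclideanSpace ℝ (Fin n) := fun q ↦ ψ (a q) h
  have hG : ContDiffAt ℝ 1 G (t₀, 0) := ψd.contDiffAt.comp (t₀, (0 : ℝ)) ha
  have hGD : ∀ y s, fderiv ℝ G (t₀, 0) (y, s) = fderiv ℝ Φ t₀ y + s • h • H v (Φ t₀) := by
    intro y s
    have h1 : HasFDerivAt G _ (t₀, 0) := HasFDerivAt.comp (g := fun q ↦ ψ q h) (t₀, (0 : ℝ))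
      (ψd.differentiable (by simp) (a (t₀, 0))).hasFDerivAt ha'
    rw [h1.fderiv]
    exact ψD _ _ _
  have hGinj : Function.Injective (fderiv ℝ G (t₀, 0)) := by
    rw [injective_iff_map_eq_zero]
    rintro ⟨y, s⟩ hys
    rw [hGD] at hys
    have hs : s = 0 := by
      by_contra hs
      refine hv (-((s * h)⁻¹ • y)) ?_
      have hsh : s * h ≠ 0 := mul_ne_zero hs hpos.ne'
      rw [map_neg, map_smul, eq_neg_of_add_eq_zero_left hys, smul_neg, neg_neg, smul_smul,
        smul_smul, mul_assoc, inv_mul_cancel₀ hsh, one_smul]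
    subst hs
    rw [zero_smul, add_zero] at hys
    rw [hinj (hys.trans (map_zero _).symm)]
    rfl
  have hc := hH.pos
  -- `δ` is the distance from `Φ t₀` to the boundary of the ball; the flow is `2`-Lipschitz, so data
  -- within `δ / 2` stay inside.
  set δ := ρ - dist (Φ t₀) (extChartAt (𝓡 n) x₀ x₀) with hδ
  have hδ0 : 0 < δ := sub_pos.2 hball
  have hrest : ∀ τ ∈ Icc 0 h, ψ (Φ t₀, 0) τ = Φ t₀ := fun τ hτ ↦ by
    rw [ψi _ τ hτ]; simp
  have hstay : ∀ q : V × ℝ, ‖a q - a (t₀, 0)‖ < δ / 2 → ∀ τ ∈ Icc 0 h,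
      ψ (a q) τ ∈ Metric.ball (extChartAt (𝓡 n) x₀ x₀) ρ := by
    intro q hq τ hτ
    have h1 := ψl τ hτ (a q) (a (t₀, 0))
    rw [show ψ (a (t₀, 0)) τ = Φ t₀ from hrest τ hτ, ← dist_eq_norm] at h1
    have h2 := dist_triangle (ψ (a q) τ) (Φ t₀) (extChartAt (𝓡 n) x₀ x₀)
    rw [Metric.mem_ball]
    linarith
  have hQ : ∀ᶠ q in 𝓝 (t₀, (0 : ℝ)), (extChartAt (𝓡 n) x₀).symm (Φ q.1) ∈ B ∧
      ‖a q - a (t₀, 0)‖ < δ / 2 := by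
    refine (continuous_fst.tendsto (t₀, (0 : ℝ)) |>.eventually hev).and ?_
    filter_upwards [ha.continuousAt.eventually (Metric.ball_mem_nhds _ (half_pos hδ0))] with q hq
    exact (dist_eq_norm (a q) (a (t₀, 0))) ▸ hq
  have hinjev : ∀ᶠ q in 𝓝 (t₀, (0 : ℝ)), Function.Injective (fderiv ℝ G q) :=
    (hG.continuousAt_fderiv (by simp)).eventually
      (ContinuousLinearMap.isOpen_injective.mem_nhds hGinj)
  have hall := ((hG.eventually (by simp)).and hinjev).and (eventually_eventually_nhds.2 hQ)
  -- Near `(t₀, 0)` the parameters `σ > 0` move forwards and may leave `B`. The disk is therefore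
  -- centred at a small `σ < 0`, where every nearby parameter moves backwards and injectivity
  -- persists by openness.
  have hcurve : Filter.Tendsto (fun σ : ℝ ↦ (t₀, σ)) (𝓝[<] 0) (𝓝 (t₀, (0 : ℝ))) :=
    ((Continuous.prodMk_right t₀).tendsto 0).mono_left nhdsWithin_le_nhds
  obtain ⟨σ, ⟨⟨hσ1, hσ2⟩, hσ3⟩, hσ⟩ := ((hcurve.eventually hall).and
    (Ioo_mem_nhdsLT (show (-1 : ℝ) < 0 by norm_num))).exists
  have hreach : ∀ q : V × ℝ, q.2 ∈ Ioo (-1 : ℝ) 0 →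
      (extChartAt (𝓡 n) x₀).symm (Φ q.1) ∈ B ∧ ‖a q - a (t₀, 0)‖ < δ / 2 →
      (extChartAt (𝓡 n) x₀).symm (G q) ∈ B := by
    rintro q hq2 ⟨hqB, hq⟩
    refine hB _ _ ?_ hqB
    have hsin : Real.sin q.2 < 0 :=
      Real.sin_neg_of_neg_of_neg_pi_lt hq2.2 (by linarith [hq2.1, Real.pi_gt_three])
    have h0 : ψ (a q) 0 = Φ q.1 := by
      rw [ψi (a q) 0 ⟨le_rfl, hpos.le⟩, intervalIntegral.integral_same, add_zero]
    rw [← h0]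
    refine hH.symm_mem_attainableSet_of_timeReversed (κ := -Real.sin q.2) hKU v hpos
      (neg_pos.2 hsin) (ψc (a q)) (fun s hs ↦ ?_) (hstay q hq)
    rw [ψi _ s hs, h0, intervalIntegral.integral_smul, neg_smul, sub_neg_eq_add]
  have hσball : G (t₀, σ) ∈ Metric.ball (extChartAt (𝓡 n) x₀ x₀) ρ :=
    hstay (t₀, σ) hσ3.self_of_nhds.2 h hh
  have hσB : ∀ᶠ q in 𝓝 (t₀, σ), (extChartAt (𝓡 n) x₀).symm (G q) ∈ B := by
    have h2 : ∀ᶠ q : V × ℝ in 𝓝 (t₀, σ), q.2 ∈ Ioo (-1 : ℝ) 0 :=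
      continuous_snd.continuousAt.eventually (isOpen_Ioo.mem_nhds hσ)
    filter_upwards [hσ3, h2] with q h1 h2
    exact hreach q h2 h1
  have hdim : Module.finrank ℝ (V × ℝ) = Module.finrank ℝ V + 1 := by simp
  exact ⟨_, hasImmersedDisk_of_immersion (Φ := G) hdim (hH.ball_subset hσball) hσ1 hσ2 hσB⟩

/-- Short trajectories transport immersed disks backwards. -/
lemma HasImmersedDisk.of_isTrajectory_of_le (hB : ∀ p q, q ∈ attainableSet F U 𝒰 p → q ∈ B → p ∈ B)
    (hH : IsChartModel F K x₀ H H' C ρ) (hw : StronglyMeasurable w)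
    (hh : 0 ≤ h) (hC : C * h ≤ 1 / 4) (hu : IsAdmissible 𝒰 U h u)
    (hγ : IsTrajectory F h u γ) (huw : ∀ᵐ t ∂volume.restrict (Icc 0 h), u t = w t)
    (hs : ∀ t ∈ Icc 0 h, γ t ∈ (extChartAt (𝓡 n) x₀).source)
    (hb : ∀ t ∈ Icc 0 h,
      extChartAt (𝓡 n) x₀ (γ t) ∈ Metric.ball (extChartAt (𝓡 n) x₀ x₀) (ρ / 2))
    (hD : HasImmersedDisk n B k (γ h)) : HasImmersedDisk n B k (γ 0) := by
  obtain ⟨Φ, hΦ, hinj, h0, hev⟩ := hD.exists_in_chart (hs h ⟨hh, le_rfl⟩)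
  obtain ⟨Ψ, hΨ, hΨinj, hΨ0, hΨev⟩ := hH.exists_backward_flow hw hh hC hu hγ huw hs hb
  refine ⟨x₀, hs 0 ⟨le_rfl, hh⟩, fun t ↦ Ψ (Φ t), hΨ.contDiffAt.comp 0 hΦ, ?_, ?_, ?_⟩
  · have h1 := (hΨ.differentiable (by simp) (Φ 0)).hasFDerivAt.comp 0
      (hΦ.differentiableAt (by simp)).hasFDerivAt
    rw [show fderiv ℝ (fun t ↦ Ψ (Φ t)) 0 = _ from h1.fderiv]
    exact (hΨinj _).comp hinj
  · exact (congrArg Ψ h0).trans hΨ0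
  · rw [← h0] at hΨev
    filter_upwards [hev, hΦ.continuousAt.eventually hΨev] with t h1 h2 using hB _ _ h2 h1

/-- Trajectories transport immersed disks backwards. -/
lemma HasImmersedDisk.of_isTrajectory (hF : IsSmoothSystem F U)
    (hU : 𝒰 = ControlClass.essentiallyBounded →
      IsClosed U ∨ IsLocallyLipschitzOnBoundedControls F U)
    (hB : ∀ p q, q ∈ attainableSet F U 𝒰 p → q ∈ B → p ∈ B) (hT : 0 ≤ T)
    (hu : IsAdmissible 𝒰 U T u) (hγ : IsTrajectory F T u γ)
    (hD : HasImmersedDisk n B k (γ T)) : HasImmersedDisk n B k (γ 0) := by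
  rcases hT.eq_or_lt with rfl | hT'
  · exact hD
  obtain ⟨K, hKU, hK, w, hw, huw⟩ := hu.exists_stronglyMeasurable hF hU hT'
  have hloc : ∀ c ∈ Icc 0 T, ∃ ε > 0, ∀ a b, 0 ≤ a → a ≤ b → b ≤ T → c - ε < a → b < c + ε →
      HasImmersedDisk n B k (γ b) → HasImmersedDisk n B k (γ a) := by
    intro c hc
    obtain ⟨H, H', C, ρ, hH⟩ := exists_isChartModel hF hKU hK (γ c)
    have hev := hγ.eventually_chart hc (Metric.ball_mem_nhds _ (half_pos hH.pos))
    obtain ⟨ε, hε, hball⟩ := Metric.mem_nhdsWithin_iff.1 hev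
    have hC0 : (0 : ℝ) ≤ C := C.2
    -- An interval within this radius of `c` has length at most `1 / (4 * (C + 1))`, as the
    -- short-time flow requires, and stays in one chart.
    refine ⟨min ε (1 / (8 * (C + 1))), by positivity, fun a b ha hab hb hca hbc hDb ↦ ?_⟩
    have hmin1 := min_le_left ε (1 / (8 * ((C : ℝ) + 1)))
    have hmin2 := min_le_right ε (1 / (8 * ((C : ℝ) + 1)))
    have hmem : ∀ t ∈ Icc 0 (b - a), t + a ∈ Metric.ball c ε ∩ Icc 0 T := by
      intro t ht
      refine ⟨?_, by linarith [ht.1], by linarith [ht.2]⟩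
      rw [Metric.mem_ball, Real.dist_eq, abs_lt]
      exact ⟨by linarith [ht.1], by linarith [ht.2]⟩
    have hlen : C * (b - a) ≤ 1 / 4 := by
      have h1 : b - a ≤ 2 * (1 / (8 * ((C : ℝ) + 1))) := by linarith
      calc C * (b - a) ≤ (C + 1) * (2 * (1 / (8 * ((C : ℝ) + 1)))) := by
            gcongr
            linarith
        _ = 1 / 4 := by field_simp; norm_num
    have := HasImmersedDisk.of_isTrajectory_of_le (k := k) hB hH (w := fun t ↦ w (t + a))
      (hw.comp_measurable (measurable_id.add_const a)) (sub_nonneg.2 hab) hlen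
      (hu.shift ha hab hb) (hγ.shift ha hb) (ae_Icc_shift ha hb huw)
      (fun t ht ↦ (hball (hmem t ht)).1) (fun t ht ↦ (hball (hmem t ht)).2) (by simpa using hDb)
    simpa using this
  -- One local step goes from a time of `J` just above its infimum to `max 0 (sInf J - ε / 2)`,
  -- which contradicts minimality unless the latter is `0`.
  let J := {t | t ∈ Icc 0 T ∧ HasImmersedDisk n B k (γ t)}
  have hTJ : T ∈ J := ⟨⟨hT, le_rfl⟩, hD⟩
  have hbdd : BddBelow J := ⟨0, fun t ht ↦ ht.1.1⟩
  have hc : sInf J ∈ Icc 0 T :=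
    ⟨le_csInf ⟨T, hTJ⟩ fun t ht ↦ ht.1.1, csInf_le hbdd hTJ⟩
  obtain ⟨ε, hε, hstep⟩ := hloc _ hc
  obtain ⟨b, hb, hbε⟩ := exists_lt_of_csInf_lt ⟨T, hTJ⟩ (show sInf J < sInf J + ε by linarith)
  have hcb : sInf J ≤ b := csInf_le hbdd hb
  obtain ⟨a, ha⟩ : ∃ a, a = max 0 (sInf J - ε / 2) := ⟨_, rfl⟩
  have ha1 : 0 ≤ a := ha ▸ le_max_left _ _
  have ha2 : sInf J - ε / 2 ≤ a := ha ▸ le_max_right _ _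
  have ha3 : a ≤ sInf J := ha ▸ max_le hc.1 (by linarith)
  have haD := hstep a b ha1 (ha3.trans hcb) hb.1.2 (by linarith) hbε hb.2
  have h1 : sInf J ≤ a := csInf_le hbdd ⟨⟨ha1, ha3.trans hc.2⟩, haD⟩
  have h2 : a = 0 := by
    rcases max_choice 0 (sInf J - ε / 2) with h | h
    · rw [ha, h]
    · rw [← ha] at h; linarith
  rwa [h2] at haD

/-- Immersed disks of maximal dimension propagate forwards along trajectories, for short times. -/
lemma HasImmersedDisk.exists_forall_le (hF : IsSmoothSystem F U)
    (hU : 𝒰 = ControlClass.essentiallyBounded →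
      IsClosed U ∨ IsLocallyLipschitzOnBoundedControls F U)
    (hB : ∀ p q, q ∈ attainableSet F U 𝒰 p → q ∈ B → p ∈ B) (hT : 0 < T)
    (hu : IsAdmissible 𝒰 U T u) (hγ : IsTrajectory F T u γ)
    (hmax : ∀ p, ¬ HasImmersedDisk n B (k + 1) p)
    (hD : HasImmersedDisk n B k (γ 0)) :
    ∃ ε ∈ Ioc 0 T, HasImmersedDisk n B k (γ ε) := by
  obtain ⟨K, hKU, hK, w, hw, huw⟩ := hu.exists_stronglyMeasurable hF hU hT
  obtain ⟨H, H', C, ρ, hH⟩ := exists_isChartModel hF hKU hK (γ 0)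
  set x₀ := γ 0 with hx₀
  obtain ⟨Φ, hΦ, hinj, h0, hev⟩ := hD.exists_in_chart (mem_extChartAt_source x₀)
  -- As a section of `L`, the disk acquires a defining equation near `z₀`: `z` lies on it when `z =
  -- σ (L z)`.
  obtain ⟨L, σ, hσ0, hσ, hLσ, hσQ⟩ := exists_section_of_immersion hΦ hinj
  rw [h0] at hσ0 hσ hLσ hσQ
  set z₀ := extChartAt (𝓡 n) x₀ x₀
  have hσball : ∀ᶠ y in 𝓝 (L z₀), σ y ∈ Metric.ball z₀ ρ :=
    hσ.continuousAt.eventually (by rw [hσ0]; exact Metric.ball_mem_nhds _ hH.pos)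
  have hσd : ∀ᶠ y in 𝓝 (L z₀), ‖fderiv ℝ σ y‖ < ‖fderiv ℝ σ (L z₀)‖ + 1 :=
    (hσ.continuousAt_fderiv (by simp)).norm.eventually (gt_mem_nhds (lt_add_one _))
  obtain ⟨r, hr, hW⟩ := Metric.eventually_nhds_iff_ball.1 (((hσ.eventually (by simp)).and
    (hLσ.and (hσQ (fun z ↦ (extChartAt (𝓡 n) x₀).symm z ∈ B) hev))).and (hσball.and hσd))
  obtain ⟨D, hDdef⟩ : ∃ D : ℝ≥0, (D : ℝ) = ‖fderiv ℝ σ (L z₀)‖ + 1 :=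
    ⟨⟨‖fderiv ℝ σ (L z₀)‖ + 1, by positivity⟩, rfl⟩
  rw [← hDdef] at hW
  have hLD : ∀ y ∈ Metric.ball (L z₀) r, ∀ x, L (fderiv ℝ σ y x) = x := by
    intro y hy x
    have h1 := L.hasFDerivAt.comp y ((hW y hy).1.1.differentiableAt (by simp)).hasFDerivAt
    have h2 : HasFDerivAt (L ∘ σ) (ContinuousLinearMap.id ℝ (Fin k → ℝ)) y :=
      (hasFDerivAt_id y).congr_of_eventuallyEq (by
        filter_upwards [Metric.isOpen_ball.mem_nhds hy] with y' hy' using (hW y' hy').1.2.1)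
    exact DFunLike.congr_fun (h1.unique h2) x
  have hinjW : ∀ y ∈ Metric.ball (L z₀) r, Function.Injective (fderiv ℝ σ y) := fun y hy ↦
    Function.LeftInverse.injective (hLD y hy)
  have hevW : ∀ y ∈ Metric.ball (L z₀) r,
      ∀ᶠ y' in 𝓝 y, (extChartAt (𝓡 n) x₀).symm (σ y') ∈ B := fun y hy ↦ by
    filter_upwards [Metric.isOpen_ball.mem_nhds hy] with y' hy' using (hW y' hy').1.2.2
  -- A vector `X` is tangent to the disk exactly when `fderiv ℝ σ y (L X) = X`. A field violating
  -- this would be transverse and would produce a `k + 1`-disk in `B`. Tangency holds along the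
  -- whole disk, which is what the Gronwall argument uses.
  have htan : ∀ y ∈ Metric.ball (L z₀) r, ∀ v, fderiv ℝ σ y (L (H v (σ y))) = H v (σ y) := by
    intro y hy v
    by_contra hne
    obtain ⟨p, hp⟩ := exists_hasImmersedDisk_succ hKU hH v hB (hW y hy).1.1 (hinjW y hy)
      (hW y hy).2.1 (hevW y hy) fun x hx ↦ hne (by rw [← hx, hLD y hy])
    exact hmax p (by simpa using hp)
  have hdisk : ∀ y ∈ Metric.ball (L z₀) r,
      HasImmersedDisk n B k ((extChartAt (𝓡 n) x₀).symm (σ y)) := fun y hy ↦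
    hasImmersedDisk_of_immersion (by simp) (hH.ball_subset (hW y hy).2.1) (hW y hy).1.1
      (hinjW y hy) (hevW y hy)
  have hσlip : LipschitzOnWith D σ (Metric.ball (L z₀) r) :=
    (convex_ball _ _).lipschitzOnWith_of_nnnorm_fderiv_le
      (fun y hy ↦ (hW y hy).1.1.differentiableAt (by simp)) fun y hy ↦ (hW y hy).2.2.le
  have hσfd : ContinuousOn (fderiv ℝ σ) (Metric.ball (L z₀) r) := fun y hy ↦
    ((hW y hy).1.1.continuousAt_fderiv (by simp)).continuousWithinAt
  -- a short time interval on which the trajectory stays where the section is defined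
  have hNmem : Metric.ball z₀ ρ ∩ L ⁻¹' Metric.ball (L z₀) r ∈ 𝓝 z₀ :=
    Filter.inter_mem (Metric.ball_mem_nhds _ hH.pos)
      (L.continuous.continuousAt.preimage_mem_nhds (Metric.ball_mem_nhds _ hr))
  obtain ⟨ε₀, hε₀, hball⟩ := Metric.mem_nhdsWithin_iff.1
    (hγ.eventually_chart (c := 0) ⟨le_rfl, hT.le⟩ hNmem)
  have hC0 : (0 : ℝ) ≤ C := C.2
  have hD0 : (0 : ℝ) ≤ D := D.2
  obtain ⟨c, hcdef⟩ : ∃ c : ℝ, c = (1 + D * ‖L‖) * C := ⟨_, rfl⟩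
  have hc0 : 0 ≤ c := by rw [hcdef]; positivity
  -- `c` will satisfy `‖g‖ ≤ c * ‖e‖`, and `ε * c ≤ 1 / 2` is the smallness needed for absorption.
  obtain ⟨ε, hεdef⟩ : ∃ ε, ε = min (ε₀ / 2) (min T (1 / (2 * (c + 1)))) := ⟨_, rfl⟩
  have hε : 0 < ε := by rw [hεdef]; positivity
  have hε1 : ε ≤ ε₀ / 2 := hεdef ▸ min_le_left _ _
  have hεT : ε ≤ T := hεdef ▸ (min_le_right _ _).trans (min_le_left _ _)
  have hεc : ε * c ≤ 1 / 2 := by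
    have h1 : ε ≤ 1 / (2 * (c + 1)) := hεdef ▸ (min_le_right _ _).trans (min_le_right _ _)
    rw [le_div_iff₀ (by positivity)] at h1
    nlinarith
  refine ⟨ε, ⟨hε, hεT⟩, ?_⟩
  have hmem : ∀ t ∈ Icc 0 ε, γ t ∈ (extChartAt (𝓡 n) x₀).source ∧
      extChartAt (𝓡 n) x₀ (γ t) ∈ Metric.ball z₀ ρ ∩ L ⁻¹' Metric.ball (L z₀) r := fun t ht ↦ by
    refine hball ⟨?_, ht.1, ht.2.trans hεT⟩
    rw [Metric.mem_ball, Real.dist_eq, sub_zero, abs_of_nonneg ht.1]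
    linarith [ht.2]
  have hγε : IsTrajectory F ε u γ := by simpa using hγ.shift le_rfl hεT
  have huwε : ∀ᵐ t ∂volume.restrict (Icc 0 ε), u t = w t :=
    ae_mono (Measure.restrict_mono (Icc_subset_Icc_right hεT) le_rfl) huw
  have hs : ∀ t ∈ Icc 0 ε, γ t ∈ (extChartAt (𝓡 n) x₀).source := fun t ht ↦ (hmem t ht).1
  have hb : ∀ t ∈ Icc 0 ε, extChartAt (𝓡 n) x₀ (γ t) ∈ Metric.ball z₀ ρ := fun t ht ↦
    (hmem t ht).2.1
  set ζ : ℝ → EuclideanSpace ℝ (Fin n) := fun t ↦ extChartAt (𝓡 n) x₀ (γ t) with hζdef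
  have hLW : ∀ t ∈ Icc 0 ε, L (ζ t) ∈ Metric.ball (L z₀) r := fun t ht ↦ (hmem t ht).2.2
  have hζc : ContinuousOn ζ (Icc 0 ε) := hγε.continuousOn_extChartAt_comp hs
  have hζlip : LipschitzOnWith C ζ (Icc 0 ε) :=
    hH.family.lipschitzOnWith_of_integral_eq hw hζc
      (hH.integral_eq hw hε.le hγε huwε hs hb)
  -- `e` measures the deviation of the trajectory from the disk, and `g` is its derivative.
  let e : ℝ → EuclideanSpace ℝ (Fin n) := fun t ↦ ζ t - σ (L (ζ t))
  let g : ℝ → EuclideanSpace ℝ (Fin n) := fun t ↦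
    H (w t) (ζ t) - fderiv ℝ σ (L (ζ t)) (L (H (w t) (ζ t)))
  have heac : AbsolutelyContinuousOnInterval e 0 ε := by
    have h1 : LipschitzOnWith (D * (‖L‖₊ * C)) (fun t ↦ σ (L (ζ t))) (Icc 0 ε) :=
      hσlip.comp (L.lipschitz.comp_lipschitzOnWith hζlip) hLW
    rw [← uIcc_of_le hε.le] at h1 hζlip
    exact hζlip.absolutelyContinuousOnInterval.fun_sub h1.absolutelyContinuousOnInterval
  have hec : ContinuousOn e (Icc 0 ε) := by
    simpa [uIcc_of_le hε.le] using heac.continuousOn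
  -- By tangency, `g` would vanish with the field evaluated at the disk point `σ (L (ζ t))` instead
  -- of `ζ t`; the Lipschitz bound on `H` controls the difference.
  have hgbound : ∀ t ∈ Icc 0 ε, ‖g t‖ ≤ c * ‖e t‖ := by
    intro t ht
    have h1 := htan _ (hLW t ht) (w t)
    have h2 : g t = (H (w t) (ζ t) - H (w t) (σ (L (ζ t)))) -
        fderiv ℝ σ (L (ζ t)) (L (H (w t) (ζ t) - H (w t) (σ (L (ζ t))))) := by
      simp only [g, map_sub, h1]
      abel
    have h3 : ‖H (w t) (ζ t) - H (w t) (σ (L (ζ t)))‖ ≤ C * ‖e t‖ := by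
      rw [← dist_eq_norm]
      exact ((hH.family.lipschitzWith (w t)).dist_le_mul _ _).trans_eq (by rw [dist_eq_norm])
    rw [h2, hcdef]
    refine (norm_sub_le _ _).trans ?_
    calc _ ≤ C * ‖e t‖ + D * (‖L‖ * (C * ‖e t‖)) := by
          refine add_le_add h3 ((ContinuousLinearMap.le_of_opNorm_le _
            (hW _ (hLW t ht)).2.2.le _).trans ?_)
          gcongr
          exact (L.le_opNorm _).trans (by gcongr)
      _ = _ := by ring
  have hgC : ∀ s ∈ Ioc 0 ε, ‖g s‖ ≤ (C + D * (‖L‖₊ * C) : ℝ≥0) := fun s hs' ↦ by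
    have h1 := hH.family.norm_le (w s) (ζ s)
    push_cast
    refine (norm_sub_le _ _).trans (add_le_add h1 ((ContinuousLinearMap.le_of_opNorm_le _
      (hW _ (hLW s (Ioc_subset_Icc_self hs'))).2.2.le _).trans ?_))
    gcongr
    exact (L.le_opNorm _).trans (by gcongr)
  have hgm : AEStronglyMeasurable g (volume.restrict (Ioc 0 ε)) := by
    have h1 : AEStronglyMeasurable (fun t ↦ H (w t) (ζ t)) (volume.restrict (Ioc 0 ε)) :=
      hH.family.continuous.comp_aestronglyMeasurable (hw.aestronglyMeasurable.prodMk
        ((hζc.mono Ioc_subset_Icc_self).aestronglyMeasurable measurableSet_Ioc))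
    have h2 : AEStronglyMeasurable (fun t ↦ fderiv ℝ σ (L (ζ t))) (volume.restrict (Ioc 0 ε)) :=
      ((hσfd.comp (L.continuous.comp_continuousOn hζc) hLW).mono
        Ioc_subset_Icc_self).aestronglyMeasurable measurableSet_Ioc
    have h3 : Continuous fun q : ((Fin k → ℝ) →L[ℝ] EuclideanSpace ℝ (Fin n)) × (Fin k → ℝ) ↦
        q.1 q.2 := by fun_prop
    exact h1.sub (h3.comp_aestronglyMeasurable
      (h2.prodMk (L.continuous.comp_aestronglyMeasurable h1)))
  have hed : ∀ᵐ t, t ∈ Ioo 0 ε → HasDerivAt e (g t) t := by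
    filter_upwards [hH.ae_hasDerivAt hγε huwε hs hb] with t ht htI
    have h1 := ht htI
    have h2 := ((hW _ (hLW t (Ioo_subset_Icc_self htI))).1.1.differentiableAt
      (by simp)).hasFDerivAt.comp_hasDerivAt t (L.hasFDerivAt.comp_hasDerivAt t h1)
    exact h1.fun_sub h2
  have heint := eq_add_integral_of_ae_hasDerivAt heac hgm hgC hed
  have he0 : e 0 = 0 := by
    simp only [e, hζdef, ← hx₀]
    rw [sub_eq_zero]
    exact hσ0.symm
  -- Since `e 0 = 0`, absorption applies with `δ = 0` and gives `e = 0`.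
  have hzero := le_two_mul_of_forall_bound (e := fun t ↦ ‖e t‖) (h := ε) (δ := 0) hec.norm
    (fun N hN t ht ↦ by
      have hN0 : 0 ≤ N := (norm_nonneg _).trans (hN t ht)
      rw [heint t ht, he0, zero_add, zero_add]
      refine (norm_integral_le_of_Icc ht (K := c * N) (by positivity) fun s hs' ↦
        (hgbound s hs').trans (by gcongr; exact hN s hs')).trans ?_
      nlinarith) ε ⟨hε.le, le_rfl⟩
  have heε : ζ ε = σ (L (ζ ε)) := by
    rw [mul_zero] at hzero
    exact sub_eq_zero.1 (norm_le_zero_iff.1 hzero)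
  have := hdisk _ (hLW ε ⟨hε.le, le_rfl⟩)
  rwa [← heε, (extChartAt (𝓡 n) x₀).left_inv (hs ε ⟨hε.le, le_rfl⟩)] at this

end Propagation

end ControlSystem

/-! ### The theorem: a maximal disk is followed from a point of `B` to `y` -/

open ControlSystem in
theorem lemma2 {n m : ℕ} {M : Type*} [TopologicalSpace M] [T2Space M] [SecondCountableTopology M]
    [ConnectedSpace M] [ChartedSpace (EuclideanSpace ℝ (Fin n)) M] [IsManifold (𝓡 n) ∞ M]
    (U : Set (EuclideanSpace ℝ (Fin m)))
    (F : (x : M) → EuclideanSpace ℝ (Fin m) → TangentSpace (𝓡 n) x)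
    (hF : ControlSystem.IsSmoothSystem F U)
    (𝒰 : ControlSystem.ControlClass)
    (hU : 𝒰 = ControlSystem.ControlClass.essentiallyBounded →
      IsClosed U ∨ ControlSystem.IsLocallyLipschitzOnBoundedControls F U)
    (hloc : ControlSystem.IsLocallyControllable F U 𝒰) (x y : M)
    (hxy : y ∈ ControlSystem.attainableSet F U 𝒰 x) :
    x ∈ ControlSystem.attainableSet F U 𝒰 y := by
  classical
  let B : Set M := {p | x ∈ attainableSet F U 𝒰 p}
  have hB : ∀ p q, q ∈ attainableSet F U 𝒰 p → q ∈ B → p ∈ B := fun p q h h' ↦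
    attainableSet_trans h h'
  have hxB : x ∈ B := show x ∈ attainableSet F U 𝒰 x from interior_subset (hloc x)
  -- Dimension `0` occurs because `x ∈ B`, and dimensions are at most `n`, so a greatest one exists.
  let k := Nat.findGreatest (fun k ↦ ∃ p, HasImmersedDisk n B k p) n
  obtain ⟨p, hp⟩ : ∃ p, HasImmersedDisk n B k p :=
    Nat.findGreatest_spec (P := fun k ↦ ∃ p, HasImmersedDisk n B k p) (Nat.zero_le n)
      ⟨x, HasImmersedDisk.zero hxB⟩
  have hmax : ∀ q, ¬ HasImmersedDisk n B (k + 1) q := fun q hq ↦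
    Nat.findGreatest_is_greatest (P := fun k ↦ ∃ p, HasImmersedDisk n B k p) (Nat.lt_succ_self k)
      hq.le ⟨q, hq⟩
  have hpy : y ∈ attainableSet F U 𝒰 p := attainableSet_trans hp.mem hxy
  obtain ⟨T, u, γ, hT, hu, hγ, rfl, rfl⟩ := hpy
  let J := {t | t ∈ Icc 0 T ∧ HasImmersedDisk n B k (γ t)}
  have h0J : 0 ∈ J := ⟨⟨le_rfl, hT⟩, hp⟩
  have hbdd : BddAbove J := ⟨T, fun t ht ↦ ht.1.2⟩
  obtain ⟨c, hcdef⟩ : ∃ c, c = sSup J := ⟨_, rfl⟩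
  have hc : c ∈ Icc 0 T :=
    hcdef ▸ ⟨le_csSup hbdd h0J, csSup_le ⟨0, h0J⟩ fun t ht ↦ ht.1.2⟩
  have hcJ : HasImmersedDisk n B k (γ c) := by
    -- By local controllability at `γ c`, the trajectory stays in the attainable set of `γ c` near
    -- time `c`, including at slightly earlier times; one of these lies in `J`, and its disk is
    -- carried back to `γ c`.
    have h1 := (hγ.1.1 c hc).eventually (mem_interior_iff_mem_nhds.1 (hloc (γ c)))
    obtain ⟨ε, hε, hball⟩ := Metric.mem_nhdsWithin_iff.1 h1
    obtain ⟨s, hs, hcs⟩ := exists_lt_of_lt_csSup ⟨0, h0J⟩ (show c - ε < sSup J by linarith)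
    have hsc : s ≤ c := hcdef ▸ le_csSup hbdd hs
    have hreach : γ s ∈ attainableSet F U 𝒰 (γ c) := hball ⟨by
      rw [Metric.mem_ball, Real.dist_eq, abs_lt]
      exact ⟨by linarith, by linarith⟩, hs.1⟩
    obtain ⟨T', u', γ', hT', hu', hγ', h0', h1'⟩ := hreach
    rw [← h0']
    exact HasImmersedDisk.of_isTrajectory hF hU hB hT' hu' hγ' (h1' ▸ hs.2)
  rcases hc.2.eq_or_lt with h | h
  · rw [h] at hcJ
    exact hcJ.mem
  -- If `c < T`, forward propagation of the maximal disk from `γ c` gives a time of `J` beyond its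
  -- supremum.
  · obtain ⟨ε, hε, hD⟩ := HasImmersedDisk.exists_forall_le (k := k) (γ := fun t ↦ γ (t + c)) hF hU hB
      (sub_pos.2 h) (hu.shift hc.1 h.le le_rfl) (hγ.shift hc.1 le_rfl) hmax (by simpa using hcJ)
    have : ε + c ≤ c := by
      nth_rewrite 2 [hcdef]
      exact le_csSup hbdd ⟨⟨by linarith [hε.1, hc.1], by linarith [hε.2]⟩, hD⟩
    linarith [hε.1]
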